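/- **Theorem 1 (maximum entropy packets).** Let $\hbar>0$ and consider a quantum system with canonical coordinates $\mathsf q_1,\dots,\mathsf q_n$ and momenta $\mathsf p_1,\dots,\mathsf p_n$, that is, the Hilbert space $L^2(\mathbb R^n)$ with $\mathsf q_k$ = multiplication by $x_k$ and $\mathsf p_k=-i\hbar\,\partial/\partial x_k$ (both self-adjoint on their maximal domains). Let real numbers $Q_k$, $P_k$ and $\Delta Q_k,\Delta P_k>0$ ($k=1,\dots,n$) be given such that $$\nu_k=\frac{2\,\Delta P_k\,\Delta Q_k}{\hbar}>1\qquad\text{for all }k .$$ Consider all states of the system, i.e. positive operators $\rho$ on $L^2(\mathbb R^n)$ with $\operatorname{tr}\rho=1$, in which each $\mathsf q_k$ has average $Q_k$ and standard deviation $\Delta Q_k$ and each $\mathsf p_k$ has average $P_k$ and standard deviation $\Delta P_k$: $$\operatorname{tr}(\rho\,\mathsf q_k)=Q_k,\quad \operatorname{tr}\bigl(\rho(\mathsf q_k-Q_k)^2\bigr)=\Delta Q_k^2,\quad \operatorname{tr}(\rho\,\mathsf p_k)=P_k,\quad \operatorname{tr}\bigl(\rho(\mathsf p_k-P_k)^2\bigr)=\Delta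 P_k^2 .$$ Then exactly one of these states has maximal von Neumann entropy $S(\rho)=-\operatorname{tr}(\rho\ln\rho)$ among all of them, namely $$\mathsf T=\prod_{k=1}^n\left[\frac{2}{\sqrt{\nu_k^2-1}}\,\exp\left(-\frac1\hbar\,\ln\frac{\nu_k+1}{\nu_k-1}\;\mathsf K_k\right)\right],$$ where $$\mathsf K_k=\frac12\,\frac{\Delta P_k}{\Delta Q_k}\,(\mathsf q_k-Q_k)^2+\frac12\,\frac{\Delta Q_k}{\Delta P_k}\,(\mathsf p_k-P_k)^2 .$$ -/

import Mathlib

open MeasureTheory Filter Topology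
open scoped ENNReal

namespace QM

section Operators

variable {H : Type*} [NormedAddCommGroup H] [InnerProductSpace ℂ H]

/-- The operator `A - a`, on the domain of `A`. -/
noncomputable def subConst (A : H →ₗ.[ℂ] H) (a : ℝ) : H →ₗ.[ℂ] H :=
  (-(a : ℂ) • (LinearMap.id : H →ₗ[ℂ] H)) +ᵥ A

/-- The composition `B A` of unbounded operators, on its natural domain
`{x ∈ dom A | A x ∈ dom B}`. -/
noncomputable def opComp (B A : H →ₗ.[ℂ] H) : H →ₗ.[ℂ] H :=
  B.comp (A.domRestrict ((B.domain.comap A.toFun).map A.domain.subtype)) (by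
    rintro ⟨x, hx⟩
    obtain ⟨⟨y, hy, hyx⟩, hxA⟩ := Submodule.mem_inf.1 hx
    have e : y = ⟨x, hxA⟩ := Subtype.ext hyx
    subst e
    exact hy)

theorem mem_opComp_domain (B A : H →ₗ.[ℂ] H) (x : H) :
    x ∈ (opComp B A).domain ↔ ∃ h : x ∈ A.domain, A ⟨x, h⟩ ∈ B.domain := by
  constructor
  · intro hx
    obtain ⟨⟨y, hy, hyx⟩, hxA⟩ := Submodule.mem_inf.1 hx
    have e : y = ⟨x, hxA⟩ := Subtype.ext hyx
    subst e
    exact ⟨hxA, hy⟩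
  · rintro ⟨h, hB⟩
    exact Submodule.mem_inf.2 ⟨⟨⟨x, h⟩, hB, rfl⟩, h⟩

/-- `U` (restricted to times `t ≥ 0`) is a strongly continuous one-parameter semigroup of bounded
operators whose infinitesimal generator is exactly `A` (same domain, same values). -/
structure IsSemigroupOf (U : ℝ → H →L[ℂ] H) (A : H →ₗ.[ℂ] H) : Prop where
  zero : U 0 = 1
  add : ∀ s t : ℝ, 0 ≤ s → 0 ≤ t → U (s + t) = U s * U t
  cont : ∀ x : H, Tendsto (fun t : ℝ => U t x) (𝓝[>] 0) (𝓝 x)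
  gen : ∀ x y : H, (x, y) ∈ A.graph ↔
    Tendsto (fun t : ℝ => ((t : ℂ)⁻¹) • (U t x - x)) (𝓝[>] 0) (𝓝 y)

open Classical in
/-- The bounded operator `exp A` of a (possibly unbounded) operator `A` that generates a strongly
continuous semigroup `exp (t A)`: the value of that semigroup at `t = 1`. The value is `0` when `A`
is not such a generator. A self-adjoint operator bounded from above is always one, and then this is
the exponential in the sense of the spectral theorem. -/
noncomputable def opExp (A : H →ₗ.[ℂ] H) : H →L[ℂ] H :=
  if h : ∃ U : ℝ → H →L[ℂ] H, IsSemigroupOf U A then h.choose 1 else 0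

end Operators

section States

variable {H : Type*} [NormedAddCommGroup H] [InnerProductSpace ℂ H]

/-- The everywhere defined operator `f` has trace `z`: in every orthonormal basis, the sum of the
diagonal matrix elements converges (unconditionally) to `z`. -/
def HasTrace (f : H → H) (z : ℂ) : Prop :=
  ∀ (s : Set H) (b : HilbertBasis s ℂ H), HasSum (fun i => inner ℂ (b i) (f (b i))) z

variable [CompleteSpace H]

/-- State operators (density operators): positive operators of trace one. -/
structure IsState (ρ : H →L[ℂ] H) : Prop where
  pos : ρ.IsPositive
  trace : HasTrace ρ 1

/-- The square root of a positive operator, by continuous functional calculus. -/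
noncomputable def sqrtOp (ρ : H →L[ℂ] H) : H →L[ℂ] H := cfc Real.sqrt ρ

/-- In the state `ρ`, the self-adjoint operator `A` has average `a` and standard deviation `s`.
The average is `tr (ρ A)`, which for unbounded `A` means `tr (√ρ A √ρ)`; the squared
deviation is `tr (ρ (A - a)²)`, which means the squared Hilbert–Schmidt norm of `(A - a) √ρ`, so
that finiteness of the second moment of `A` is part of the condition. -/
structure HasMeanStd (ρ : H →L[ℂ] H) (A : H →ₗ.[ℂ] H) (a s : ℝ) : Prop where
  mem : ∀ x : H, sqrtOp ρ x ∈ A.domain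
  mean : HasTrace (fun x => sqrtOp ρ (A ⟨sqrtOp ρ x, mem x⟩)) (a : ℂ)
  var : ∀ (t : Set H) (b : HilbertBasis t ℂ H),
    HasSum (fun i => ‖A ⟨sqrtOp ρ (b i), mem (b i)⟩ - (a : ℂ) • sqrtOp ρ (b i)‖ ^ 2) (s ^ 2)

/-- Some orthonormal basis of `H` (the index set). -/
noncomputable def basisSet (H : Type*) [NormedAddCommGroup H] [InnerProductSpace ℂ H]
    [CompleteSpace H] : Set H := (exists_hilbertBasis ℂ H).choose

/-- Some orthonormal basis of `H`. -/
noncomputable def someBasis (H : Type*) [NormedAddCommGroup H] [InnerProductSpace ℂ H]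
    [CompleteSpace H] : HilbertBasis (basisSet H) ℂ H :=
  (exists_hilbertBasis ℂ H).choose_spec.choose

/-- The trace, in `[0, ∞]`, of a positive bounded operator (it does not depend on the basis). -/
noncomputable def posTrace (B : H →L[ℂ] H) : ℝ≥0∞ :=
  ∑' i, ENNReal.ofReal (inner ℂ (someBasis H i) (B (someBasis H i))).re

/-- The von Neumann entropy `S(ρ) = - tr (ρ ln ρ) ∈ [0, ∞]` of a state operator; the operator
`- ρ ln ρ` (with `0 ln 0 = 0`) is given by continuous functional calculus. -/
noncomputable def vonNeumannEntropy (ρ : H →L[ℂ] H) : ℝ≥0∞ :=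
  posTrace (cfc Real.negMulLog ρ)

end States

section Canonical

/-- The Hilbert space `L²(ℝⁿ)` of a system with `n` canonical coordinates and momenta. -/
abbrev Wave (n : ℕ) : Type :=
  Lp ℂ 2 (volume : Measure (EuclideanSpace ℝ (Fin n)))

variable {n : ℕ}

/-- The maximal domain `{ψ ∈ L² | x_k ψ ∈ L²}` of multiplication by the `k`-th coordinate. -/
def positionDomain (k : Fin n) : Submodule ℂ (Wave n) where
  carrier := {ψ | MemLp (fun x : EuclideanSpace ℝ (Fin n) => ((x k : ℝ) : ℂ) * ψ x) 2 volume}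
  add_mem' := by
    intro ψ φ hψ hφ
    refine (MemLp.add hψ hφ).ae_eq ?_
    filter_upwards [Lp.coeFn_add ψ φ] with x hx
    rw [Pi.add_apply, hx, Pi.add_apply, mul_add]
  zero_mem' := by
    refine (MemLp.zero (ε := ℂ)).ae_eq ?_
    filter_upwards [Lp.coeFn_zero ℂ 2 (volume : Measure (EuclideanSpace ℝ (Fin n)))] with x hx
    rw [hx, Pi.zero_apply, mul_zero]
  smul_mem' := by
    intro c ψ hψ
    refine (MemLp.const_smul hψ c).ae_eq ?_
    filter_upwards [Lp.coeFn_smul c ψ] with x hx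
    rw [Pi.smul_apply, hx, Pi.smul_apply, smul_eq_mul, smul_eq_mul, mul_left_comm]

theorem mem_positionDomain (k : Fin n) (ψ : Wave n) : ψ ∈ positionDomain k ↔
    MemLp (fun x : EuclideanSpace ℝ (Fin n) => ((x k : ℝ) : ℂ) * ψ x) 2 volume := Iff.rfl

/-- The position operator `q_k`: multiplication by the `k`-th coordinate, on its maximal domain. -/
noncomputable def position (k : Fin n) : Wave n →ₗ.[ℂ] Wave n where
  domain := positionDomain k
  toFun :=
    { toFun := fun ψ => MemLp.toLp
        (fun x : EuclideanSpace ℝ (Fin n) => ((x k : ℝ) : ℂ) * (ψ : Wave n) x)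
        ((mem_positionDomain k ψ).1 ψ.2)
      map_add' := by
        intro ψ φ
        refine (MemLp.toLp_congr _
          (((mem_positionDomain k ψ).1 ψ.2).add ((mem_positionDomain k φ).1 φ.2)) ?_).trans
          (MemLp.toLp_add _ _)
        filter_upwards [Lp.coeFn_add (ψ : Wave n) (φ : Wave n)] with x hx
        rw [Submodule.coe_add, hx, Pi.add_apply, Pi.add_apply, mul_add]
      map_smul' := by
        intro c ψ
        refine (MemLp.toLp_congr _
          (((mem_positionDomain k ψ).1 ψ.2).const_smul c) ?_).trans
          (MemLp.toLp_const_smul c _)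
        filter_upwards [Lp.coeFn_smul c (ψ : Wave n)] with x hx
        rw [Submodule.coe_smul, hx, Pi.smul_apply, Pi.smul_apply, smul_eq_mul, smul_eq_mul,
          mul_left_comm] }

/-- The Fourier transform `ψ ↦ ∫ ψ(x) exp (-2πi ⟨x, ξ⟩) dx` on `L²(ℝⁿ)`, a unitary operator. -/
noncomputable def fourierL2 (n : ℕ) : Wave n ≃ₗᵢ[ℂ] Wave n :=
  Lp.fourierTransformₗᵢ (EuclideanSpace ℝ (Fin n)) ℂ

/-- The momentum operator `p_k = -iħ ∂_k` as a self-adjoint operator: the Fourier transform turns it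
into multiplication by `2πħ ξ_k`, and its domain consists of all `ψ ∈ L²` such that
`ξ_k (𝓕 ψ)(ξ)` is in `L²`. -/
noncomputable def momentum (ħ : ℝ) (k : Fin n) : Wave n →ₗ.[ℂ] Wave n where
  domain := (position k).domain.comap (fourierL2 n).toLinearEquiv.toLinearMap
  toFun := ((2 * Real.pi * ħ : ℝ) : ℂ) •
    ((fourierL2 n).symm.toLinearEquiv.toLinearMap ∘ₗ (position k).toFun ∘ₗ
      ((fourierL2 n).toLinearEquiv.toLinearMap.restrict (fun _ h => h)))

/-- `K_k = ½ (ΔP/ΔQ) (q_k - Q)² + ½ (ΔQ/ΔP) (p_k - P)²`. -/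
noncomputable def opK (ħ : ℝ) (k : Fin n) (Q P ΔQ ΔP : ℝ) : Wave n →ₗ.[ℂ] Wave n :=
  ((1 / 2 * (ΔP / ΔQ) : ℝ) : ℂ) •
      opComp (subConst (position k) Q) (subConst (position k) Q) +
    ((1 / 2 * (ΔQ / ΔP) : ℝ) : ℂ) •
      opComp (subConst (momentum ħ k) P) (subConst (momentum ħ k) P)

/-- `ν = 2 ΔP ΔQ / ħ`. -/
noncomputable def nu (ħ ΔQ ΔP : ℝ) : ℝ := 2 * ΔP * ΔQ / ħ

/-- The operator
`T = ∏_k [2 / √(ν_k² - 1)] exp (-(1/ħ) ln ((ν_k + 1) / (ν_k - 1)) K_k)`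
(the factors are multiplied in the order `k = 1, …, n`; the empty product is the identity). -/
noncomputable def packetT (ħ : ℝ) (Q P ΔQ ΔP : Fin n → ℝ) : Wave n →L[ℂ] Wave n :=
  (List.ofFn fun k : Fin n =>
    ((2 / Real.sqrt (nu ħ (ΔQ k) (ΔP k) ^ 2 - 1) : ℝ) : ℂ) •
      opExp (((-(1 / ħ) *
          Real.log ((nu ħ (ΔQ k) (ΔP k) + 1) / (nu ħ (ΔQ k) (ΔP k) - 1)) : ℝ) : ℂ) •
        opK ħ k (Q k) (P k) (ΔQ k) (ΔP k))).prod

/-- `ρ` is a state in which, for every `k`, the coordinate `q_k` has average `Q k` and standard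
deviation `ΔQ k`, and the momentum `p_k` has average `P k` and standard deviation `ΔP k`. -/
structure HasAveragesAndVariances (ħ : ℝ) (Q P ΔQ ΔP : Fin n → ℝ) (ρ : Wave n →L[ℂ] Wave n) :
    Prop where
  state : IsState ρ
  coord : ∀ k, HasMeanStd ρ (position k) (Q k) (ΔQ k)
  mom : ∀ k, HasMeanStd ρ (momentum ħ k) (P k) (ΔP k)

/-- `ρ` is a maximum entropy packet: a state with the given averages and variances whose
von Neumann entropy is maximal among all such states. -/
structure IsMaxEntropyPacket (ħ : ℝ) (Q P ΔQ ΔP : Fin n → ℝ) (ρ : Wave n →L[ℂ] Wave n) :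
    Prop where
  constraints : HasAveragesAndVariances ħ Q P ΔQ ΔP ρ
  maximal : ∀ σ : Wave n →L[ℂ] Wave n, HasAveragesAndVariances ħ Q P ΔQ ΔP σ →
    vonNeumannEntropy σ ≤ vonNeumannEntropy ρ

end Canonical

end QM

namespace QM

section HilbertBasis

variable {H : Type*} [NormedAddCommGroup H] [InnerProductSpace ℂ H]
variable {ι : Type*}

theorem hasSum_norm_inner_sq (b : HilbertBasis ι ℂ H) (x : H) :
    HasSum (fun i => ‖inner ℂ (b i) x‖ ^ 2) (‖x‖ ^ 2) := by
  have h := Complex.hasSum_re (b.hasSum_inner_mul_inner x x)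
  rw [inner_self_eq_norm_sq_to_K] at h
  convert! h using 1
  · ext i
    rw [← inner_conj_symm x (b i), Complex.conj_mul']
    norm_cast
  · norm_cast

theorem eq_of_inner_basis (b : HilbertBasis ι ℂ H) {x y : H}
    (h : ∀ i, inner ℂ (b i) x = inner ℂ (b i) y) : x = y := by
  apply b.repr.injective
  ext i
  rw [b.repr_apply_apply, b.repr_apply_apply, h]

theorem exists_inner_basis_eq (b : HilbertBasis ι ℂ H) {c : ι → ℂ}
    (h : Summable fun i => ‖c i‖ ^ 2) : ∃ x, ∀ i, inner ℂ (b i) x = c i := by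
  have hc : Memℓp c 2 := by
    refine memℓp_gen ?_
    convert! h using 2 with i
    norm_num
  refine ⟨b.repr.symm ⟨c, hc⟩, fun i => ?_⟩
  rw [← b.repr_apply_apply, LinearIsometryEquiv.apply_symm_apply]

theorem inner_basis_self (b : HilbertBasis ι ℂ H) [DecidableEq ι] (i j : ι) :
    inner ℂ (b i) (b j) = if i = j then 1 else 0 :=
  orthonormal_iff_ite.1 b.orthonormal i j

theorem norm_basis (b : HilbertBasis ι ℂ H) (i : ι) : ‖b i‖ = 1 := b.orthonormal.1 i

/-- Dominated convergence of the coefficients in a Hilbert basis. -/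
theorem tendsto_of_tendsto_coeff (b : HilbertBasis ι ℂ H) {T : Type*} {l : Filter T} {v : T → H}
    {y : H} {D : ι → ℝ} (hD : Summable fun i => D i ^ 2)
    (hlim : ∀ i, Tendsto (fun t => inner ℂ (b i) (v t)) l (𝓝 (inner ℂ (b i) y)))
    (hbound : ∀ᶠ t in l, ∀ i, ‖inner ℂ (b i) (v t) - inner ℂ (b i) y‖ ≤ D i) :
    Tendsto v l (𝓝 y) := by
  rw [tendsto_iff_norm_sub_tendsto_zero]
  have key : Tendsto (fun t => ‖v t - y‖ ^ 2) l (𝓝 0) := by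
    have e : (fun t => ‖v t - y‖ ^ 2) =
        fun t => ∑' i, ‖inner ℂ (b i) (v t) - inner ℂ (b i) y‖ ^ 2 := by
      ext t
      rw [← (hasSum_norm_inner_sq b (v t - y)).tsum_eq]
      simp_rw [inner_sub_right]
    rw [e, ← tsum_zero (α := ℝ) (β := ι)]
    refine tendsto_tsum_of_dominated_convergence hD (fun i => ?_) ?_
    · have := ((hlim i).sub_const (inner ℂ (b i) y)).norm.pow 2
      simpa using this
    · filter_upwards [hbound] with t ht i
      rw [Real.norm_of_nonneg (by positivity)]
      gcongr
      exact ht i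
  have := key.sqrt
  simpa using this

theorem inner_basis_apply_of_eigen [CompleteSpace H] (b : HilbertBasis ι ℂ H) {A : H →L[ℂ] H}
    {d : ι → ℂ} (hA : ∀ i, A (b i) = d i • b i) (x : H) (i : ι) :
    inner ℂ (b i) (A x) = d i * inner ℂ (b i) x := by
  classical
  have h := ((b.hasSum_repr x).mapL A).mapL (innerSL ℂ (b i))
  refine h.unique ?_
  convert! hasSum_ite_eq i (d i * inner ℂ (b i) x) using 1
  ext j
  rw [map_smul, hA, innerSL_apply_apply, b.repr_apply_apply, inner_smul_right, inner_smul_right,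
    inner_basis_self]
  by_cases hij : i = j
  · subst hij; simp [mul_comm]
  · simp [hij, Ne.symm hij]

/-- The bounded operator with given bounded eigenvalues in a Hilbert basis. -/
theorem exists_diagonal (b : HilbertBasis ι ℂ H) {d : ι → ℂ} {M : ℝ} (hM : 0 ≤ M)
    (hd : ∀ i, ‖d i‖ ≤ M) :
    ∃ A : H →L[ℂ] H, ∀ x i, inner ℂ (b i) (A x) = d i * inner ℂ (b i) x := by
  have hex : ∀ x : H, ∃ y, ∀ i, inner ℂ (b i) y = d i * inner ℂ (b i) x := fun x => by
    refine exists_inner_basis_eq b (.of_nonneg_of_le (fun i => by positivity) (fun i => ?_)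
      ((hasSum_norm_inner_sq b x).summable.mul_left (M ^ 2)))
    rw [norm_mul, mul_pow]
    gcongr
    exact hd i
  choose f hf using hex
  refine ⟨LinearMap.mkContinuous
    { toFun := f
      map_add' := fun x y => eq_of_inner_basis b fun i => by
        simp only [hf, inner_add_right, mul_add]
      map_smul' := fun c x => eq_of_inner_basis b fun i => by
        simp only [hf, inner_smul_right, RingHom.id_apply]; ring } M fun x => ?_, hf⟩
  refine abs_le_of_sq_le_sq' ?_ (by positivity) |>.2
  refine (hasSum_le (fun i => ?_) (hasSum_norm_inner_sq b (f x))
    ((hasSum_norm_inner_sq b x).mul_left (M ^ 2))).trans_eq (mul_pow _ _ _).symm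
  rw [hf, norm_mul, mul_pow]
  gcongr
  exact hd i

theorem ofReal_norm_sq_eq_tsum (b : HilbertBasis ι ℂ H) (x : H) :
    ENNReal.ofReal (‖x‖ ^ 2) = ∑' i, ENNReal.ofReal (‖inner ℂ (b i) x‖ ^ 2) := by
  rw [← (hasSum_norm_inner_sq b x).tsum_eq]
  exact ENNReal.ofReal_tsum_of_nonneg (fun _ => by positivity) (hasSum_norm_inner_sq b x).summable

/-- The sum of `‖B (b i)‖ ^ 2` over an orthonormal basis, expressed through a formal adjoint. -/
theorem tsum_enorm_sq_eq_of_formalAdjoint {κ : Type*} (h : HilbertBasis ι ℂ H)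
    (b : HilbertBasis κ ℂ H) {B : H → H} {B' : ι → H}
    (hB : ∀ i x, inner ℂ (h i) (B x) = inner ℂ (B' i) x) :
    ∑' j, ENNReal.ofReal (‖B (b j)‖ ^ 2) = ∑' i, ENNReal.ofReal (‖B' i‖ ^ 2) := by
  calc _ = ∑' j, ∑' i, ENNReal.ofReal (‖inner ℂ (h i) (B (b j))‖ ^ 2) := by
        simp_rw [← ofReal_norm_sq_eq_tsum h]
    _ = ∑' i, ∑' j, ENNReal.ofReal (‖inner ℂ (B' i) (b j)‖ ^ 2) := by
        rw [ENNReal.tsum_comm]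
        simp_rw [hB]
    _ = _ := by simp_rw [norm_inner_symm (B' _), ← ofReal_norm_sq_eq_tsum b]

theorem hasSum_norm_sq_of_formalAdjoint {κ : Type*} (h : HilbertBasis ι ℂ H)
    {B : H → H} {B' : ι → H}
    (hB : ∀ i x, inner ℂ (h i) (B x) = inner ℂ (B' i) x) {s : ℝ}
    (hs : HasSum (fun i => ‖B (h i)‖ ^ 2) s) (b : HilbertBasis κ ℂ H) :
    HasSum (fun i => ‖B (b i)‖ ^ 2) s := by
  have e := (tsum_enorm_sq_eq_of_formalAdjoint h b hB).trans
    (tsum_enorm_sq_eq_of_formalAdjoint h h hB).symm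
  rw [← ENNReal.ofReal_tsum_of_nonneg (fun _ => by positivity) hs.summable, hs.tsum_eq] at e
  have hsum : Summable fun i => ‖B (b i)‖ ^ 2 := by
    refine (ENNReal.summable_toReal (e ▸ ENNReal.ofReal_ne_top)).congr fun i => ?_
    rw [ENNReal.toReal_ofReal (by positivity)]
  rw [← ENNReal.ofReal_tsum_of_nonneg (fun _ => by positivity) hsum] at e
  have := (ENNReal.ofReal_eq_ofReal_iff (tsum_nonneg fun _ => by positivity)
    (hs.nonneg fun _ => by positivity)).1 e
  exact this ▸ hsum.hasSum

end HilbertBasis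

section Calculus

variable {H : Type*} [NormedAddCommGroup H] [InnerProductSpace ℂ H] [CompleteSpace H]

/-- The functional calculus acts on eigenvectors through the eigenvalues. -/
theorem cfc_apply_of_eigen {A : H →L[ℂ] H} (hA : IsSelfAdjoint A) {f : ℝ → ℝ}
    (hf : ContinuousOn f (spectrum ℝ A)) {x : H} {t : ℝ} (hx : A x = (t : ℂ) • x) :
    cfc f A x = (f t : ℂ) • x := by
  rcases eq_or_ne x 0 with rfl | hx0
  · simp
  have ht : t ∈ spectrum ℝ A := by
    intro hu
    obtain ⟨u, hu⟩ := hu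
    have h1 : (u : H →L[ℂ] H) x = 0 := by
      rw [hu]
      simp [Algebra.algebraMap_eq_smul_one, hx]
    have h2 : ((↑u⁻¹ : H →L[ℂ] H) * (u : H →L[ℂ] H)) x = 0 := by
      rw [mul_apply_eq_comp, h1, map_zero]
    rw [Units.inv_mul] at h2
    exact hx0 h2
  suffices key : ∀ g : C(spectrum ℝ A, ℝ), cfcHom hA g x = (g ⟨t, ht⟩ : ℂ) • x by
    rw [cfc_apply f A hA hf, key]
    rfl
  intro g
  induction g using ContinuousMap.induction_on_of_compact with
  | const r =>
    have : cfcHom hA (ContinuousMap.const _ r) = algebraMap ℝ (H →L[ℂ] H) r :=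
      AlgHomClass.commutes (cfcHom hA) r
    rw [this]
    simp [Algebra.algebraMap_eq_smul_one]
  | id => rw [cfcHom_id, hx]; rfl
  | star_id => rw [star_trivial, cfcHom_id, hx]; rfl
  | add f g hf hg => simp [map_add, hf, hg, add_smul]
  | mul f g hf hg => simp [map_mul, hf, hg, mul_smul]; rw [smul_comm]
  | frequently f hf =>
    have hc : IsClosed {g : C(spectrum ℝ A, ℝ) | cfcHom hA g x = (g ⟨t, ht⟩ : ℂ) • x} := by
      refine isClosed_eq ?_ ?_
      · exact (ContinuousLinearMap.apply ℂ H x).continuous.comp (cfcHom_continuous hA)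
      · fun_prop
    exact hc.closure_subset (mem_closure_iff_frequently.2 hf)

end Calculus

section Semigroup

variable {H : Type*} [NormedAddCommGroup H] [InnerProductSpace ℂ H]

theorem IsSemigroupOf.tendsto_nhdsGE {U : ℝ → H →L[ℂ] H} {A : H →ₗ.[ℂ] H}
    (hU : IsSemigroupOf U A) (x : H) : Tendsto (fun t => U t x) (𝓝[≥] 0) (𝓝 x) := by
  have h : ContinuousWithinAt (fun t => U t x) (Set.Ioi 0) 0 := by
    simpa [ContinuousWithinAt, hU.zero] using hU.cont x
  simpa [ContinuousWithinAt, hU.zero] using continuousWithinAt_Ioi_iff_Ici.1 h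

theorem IsSemigroupOf.exists_bound [CompleteSpace H] {U : ℝ → H →L[ℂ] H} {A : H →ₗ.[ℂ] H}
    (hU : IsSemigroupOf U A) : ∃ δ > 0, ∃ M, ∀ t, 0 ≤ t → t ≤ δ → ‖U t‖ ≤ M := by
  by_contra! hcon
  choose! t ht0 htn hbig using fun n : ℕ => hcon (1 / ((n : ℝ) + 1)) (by positivity) n
  have hlim : Tendsto t atTop (𝓝[≥] 0) :=
    tendsto_nhdsWithin_iff.2 ⟨squeeze_zero ht0 htn tendsto_one_div_add_atTop_nhds_zero_nat,
      .of_forall ht0⟩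
  obtain ⟨C, hC⟩ := banach_steinhaus (g := fun n => U (t n)) fun x => by
    obtain ⟨C, hC⟩ := ((hU.tendsto_nhdsGE x).comp hlim).norm.bddAbove_range
    exact ⟨C, fun n => hC ⟨n, rfl⟩⟩
  obtain ⟨n, hn⟩ := exists_nat_gt C
  exact absurd (hC n) (not_le.2 (hn.trans (hbig n)))

theorem IsSemigroupOf.continuousOn [CompleteSpace H] {U : ℝ → H →L[ℂ] H} {A : H →ₗ.[ℂ] H}
    (hU : IsSemigroupOf U A) (x : H) : ContinuousOn (fun t => U t x) (Set.Ici 0) := by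
  obtain ⟨δ, hδ, M, hM⟩ := hU.exists_bound
  intro t ht
  have ht0 : 0 ≤ t := ht
  have hsub : Set.Ici (0 : ℝ) ⊆ Set.Icc 0 t ∪ Set.Ici t := by
    intro s hs
    rcases le_total s t with h | h
    exacts [Or.inl ⟨hs, h⟩, Or.inr h]
  refine ContinuousWithinAt.mono (continuousWithinAt_union.2 ⟨?_, ?_⟩) hsub
  · rcases ht0.eq_or_lt with rfl | htpos
    · rw [Set.Icc_self]
      exact continuousWithinAt_singleton
    set ε := min δ t with hε
    have hε0 : 0 < ε := lt_min hδ htpos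
    have hM0 : 0 ≤ M := (norm_nonneg _).trans (hM 0 le_rfl hδ.le)
    rw [ContinuousWithinAt, tendsto_iff_norm_sub_tendsto_zero]
    have h1 : Tendsto (fun s => t - s) (𝓝[Set.Icc 0 t] t) (𝓝[≥] 0) := by
      refine tendsto_nhdsWithin_iff.2 ⟨?_, ?_⟩
      · have : Tendsto (fun s => t - s) (𝓝 t) (𝓝 (t - t)) := tendsto_id.const_sub t
        rw [sub_self] at this
        exact this.mono_left nhdsWithin_le_nhds
      · filter_upwards [self_mem_nhdsWithin] with s hs
        exact sub_nonneg.2 hs.2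
    have h2 : Tendsto (fun s => ‖U (t - ε)‖ * M * ‖U (t - s) x - x‖) (𝓝[Set.Icc 0 t] t) (𝓝 0) := by
      have := (tendsto_iff_norm_sub_tendsto_zero.1 ((hU.tendsto_nhdsGE x).comp h1)).const_mul
        (‖U (t - ε)‖ * M)
      simpa using this
    refine squeeze_zero' (.of_forall fun s => norm_nonneg _) ?_ h2
    have h3 : ∀ᶠ s in 𝓝[Set.Icc 0 t] t, t - ε < s :=
      nhdsWithin_le_nhds (lt_mem_nhds (by linarith))
    filter_upwards [self_mem_nhdsWithin, h3] with s hs hs'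
    have e1 : U t = U s * U (t - s) := by
      rw [← hU.add _ _ hs.1 (sub_nonneg.2 hs.2)]; congr 1; ring
    have e2 : U s = U (t - ε) * U (s - (t - ε)) := by
      rw [← hU.add _ _ (sub_nonneg.2 (min_le_right _ _)) (by linarith)]; congr 1; ring
    have e3 : U s x - U t x = - U (t - ε) (U (s - (t - ε)) (U (t - s) x - x)) := by
      rw [e1, mul_apply_eq_comp, map_sub, map_sub]
      conv_lhs => rw [e2]
      simp
    rw [e3, norm_neg, mul_assoc]
    refine (ContinuousLinearMap.le_opNorm _ _).trans ?_
    gcongr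
    refine (ContinuousLinearMap.le_opNorm _ _).trans ?_
    gcongr
    exact hM _ (by linarith) (by linarith [hs.2, min_le_left δ t])
  · have h1 : Tendsto (fun s => s - t) (𝓝[≥] t) (𝓝[≥] 0) := by
      refine tendsto_nhdsWithin_iff.2 ⟨?_, ?_⟩
      · have : Tendsto (fun s => s - t) (𝓝 t) (𝓝 (t - t)) := tendsto_id.sub_const t
        rw [sub_self] at this
        exact this.mono_left nhdsWithin_le_nhds
      · filter_upwards [self_mem_nhdsWithin] with s hs
        exact sub_nonneg.2 (Set.mem_Ici.1 hs)
    have h2 := ((U t).continuous.tendsto x).comp ((hU.tendsto_nhdsGE x).comp h1)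
    refine h2.congr' ?_
    filter_upwards [self_mem_nhdsWithin] with s hs
    simp only [Function.comp_apply]
    rw [← mul_apply_eq_comp, ← hU.add _ _ ht0 (sub_nonneg.2 (Set.mem_Ici.1 hs))]
    congr 2; ring

theorem IsSemigroupOf.hasDerivWithinAt {U : ℝ → H →L[ℂ] H} {A : H →ₗ.[ℂ] H}
    (hU : IsSemigroupOf U A) {x y : H} (hxy : (x, y) ∈ A.graph) {t : ℝ} (ht : 0 ≤ t) :
    HasDerivWithinAt (fun s => U s x) (U t y) (Set.Ici t) t := by
  rw [← hasDerivWithinAt_Ioi_iff_Ici, hasDerivWithinAt_iff_tendsto_slope' (by simp)]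
  have h1 : Tendsto (fun s => s - t) (𝓝[>] t) (𝓝[>] 0) := by
    refine tendsto_nhdsWithin_iff.2 ⟨?_, ?_⟩
    · have : Tendsto (fun s => s - t) (𝓝 t) (𝓝 (t - t)) := tendsto_id.sub_const t
      rw [sub_self] at this
      exact this.mono_left nhdsWithin_le_nhds
    · filter_upwards [self_mem_nhdsWithin] with s hs
      exact sub_pos.2 (Set.mem_Ioi.1 hs)
  have h2 := ((U t).continuous.tendsto y).comp (((hU.gen x y).1 hxy).comp h1)
  refine h2.congr' ?_
  filter_upwards [self_mem_nhdsWithin] with s hs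
  have e : U s = U t * U (s - t) := by
    rw [← hU.add _ _ ht (sub_pos.2 (Set.mem_Ioi.1 hs)).le]; congr 1; ring
  simp only [Function.comp_apply, slope, vsub_eq_sub]
  rw [e, map_smul, map_sub, mul_apply_eq_comp, ← Complex.ofReal_inv, Complex.coe_smul]

/-- A semigroup multiplies the eigenvectors of its generator by exponentials. -/
theorem IsSemigroupOf.apply_of_eigen [CompleteSpace H] {U : ℝ → H →L[ℂ] H} {A : H →ₗ.[ℂ] H}
    (hU : IsSemigroupOf U A) {x : H} {l : ℝ} (hx : (x, (l : ℂ) • x) ∈ A.graph) :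
    U 1 x = (Real.exp l : ℂ) • x := by
  have hcont : ContinuousOn (fun t : ℝ => Real.exp (-(l * t)) • U t x) (Set.Icc 0 1) :=
    (show Continuous fun t : ℝ => Real.exp (-(l * t)) by fun_prop).continuousOn.smul ((hU.continuousOn x).mono fun t ht => ht.1)
  have hder : ∀ t ∈ Set.Ico (0 : ℝ) 1,
      HasDerivWithinAt (fun t : ℝ => Real.exp (-(l * t)) • U t x) 0 (Set.Ici t) t := by
    intro t ht
    have h1 := hU.hasDerivWithinAt hx ht.1
    have h2 : HasDerivAt (fun t : ℝ => Real.exp (-(l * t))) (Real.exp (-(l * t)) * -(l * 1)) t :=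
      (((hasDerivAt_id t).const_mul l).neg).exp
    convert! h2.hasDerivWithinAt.smul h1 using 1
    rw [map_smul, Complex.coe_smul, smul_smul, ← add_smul]
    simp
  have h := constant_of_has_deriv_right_zero hcont hder 1 ⟨zero_le_one, le_rfl⟩
  simp only [mul_one, mul_zero, neg_zero, Real.exp_zero, one_smul, hU.zero,
    one_apply_eq_self] at h
  have e : U 1 x = Real.exp l • Real.exp (-l) • U 1 x := by
    rw [smul_smul, ← Real.exp_add, add_neg_cancel, Real.exp_zero, one_smul]
  rw [e, h, Complex.coe_smul]

/-- An operator that is diagonal on its maximal domain, with nonpositive eigenvalues, generates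
the semigroup of diagonal contractions. -/
theorem exists_isSemigroupOf_of_diagonal {ι : Type*} (b : HilbertBasis ι ℂ H) {A : H →ₗ.[ℂ] H}
    {d : ι → ℝ} (hd : ∀ i, d i ≤ 0)
    (hA : ∀ x y, (x, y) ∈ A.graph ↔ ∀ i, inner ℂ (b i) y = (d i : ℂ) * inner ℂ (b i) x) :
    ∃ U : ℝ → H →L[ℂ] H, IsSemigroupOf U A := by
  have hex : ∀ t : ℝ, ∃ V : H →L[ℂ] H, ∀ x i,
      inner ℂ (b i) (V x) = (Real.exp (max t 0 * d i) : ℂ) * inner ℂ (b i) x := fun t => by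
    refine exists_diagonal b zero_le_one fun i => ?_
    rw [Complex.norm_real, Real.norm_of_nonneg (by positivity), Real.exp_le_one_iff]
    exact mul_nonpos_of_nonneg_of_nonpos (le_max_right _ _) (hd i)
  choose U hU using hex
  have hU' : ∀ t : ℝ, 0 ≤ t → ∀ x i,
      inner ℂ (b i) (U t x) = (Real.exp (t * d i) : ℂ) * inner ℂ (b i) x := fun t ht x i => by
    rw [hU, max_eq_left ht]
  have hcoef : ∀ (x : H) (t : ℝ), 0 < t → ∀ i, inner ℂ (b i) ((t : ℂ)⁻¹ • (U t x - x)) =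
      (((Real.exp (t * d i) - 1) / t : ℝ) : ℂ) * inner ℂ (b i) x := fun x t ht i => by
    rw [inner_smul_right, inner_sub_right, hU' t ht.le]
    push_cast
    ring
  have hquot : ∀ i, Tendsto (fun t : ℝ => (Real.exp (t * d i) - 1) / t) (𝓝[>] 0) (𝓝 (d i)) := by
    intro i
    have h : HasDerivAt (fun t : ℝ => Real.exp (t * d i)) (d i) 0 := by
      have := ((hasDerivAt_id (0 : ℝ)).mul_const (d i)).exp
      simpa using this
    have := (hasDerivWithinAt_iff_tendsto_slope' (by simp)).1 (h.hasDerivWithinAt (s := Set.Ioi 0))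
    refine this.congr fun t => ?_
    simp [slope, div_eq_inv_mul]
  refine ⟨U, ?_, ?_, ?_, ?_⟩
  · ext x
    refine eq_of_inner_basis b fun i => ?_
    simp [hU]
  · intro s t hs ht
    ext x
    refine eq_of_inner_basis b fun i => ?_
    rw [mul_apply_eq_comp, hU' _ (add_nonneg hs ht), hU' _ hs, hU' _ ht, add_mul, Real.exp_add]
    push_cast
    ring
  · intro x
    refine tendsto_of_tendsto_coeff b (hasSum_norm_inner_sq b x).summable (fun i => ?_) ?_
    · have h : Tendsto (fun t : ℝ => (Real.exp (max t 0 * d i) : ℂ) * inner ℂ (b i) x) (𝓝[>] 0)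
          (𝓝 ((Real.exp (max 0 0 * d i) : ℂ) * inner ℂ (b i) x)) :=
        (Continuous.tendsto (by fun_prop) 0).mono_left nhdsWithin_le_nhds
      simpa [hU] using h
    · filter_upwards [self_mem_nhdsWithin] with t ht i
      have h0 : t * d i ≤ 0 := mul_nonpos_of_nonneg_of_nonpos (le_of_lt ht) (hd i)
      rw [hU' t (le_of_lt ht), ← sub_one_mul, norm_mul]
      refine mul_le_of_le_one_left (norm_nonneg _) ?_
      rw [← Complex.ofReal_one, ← Complex.ofReal_sub, Complex.norm_real, Real.norm_eq_abs, abs_le]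
      have := Real.exp_pos (t * d i)
      have := Real.exp_le_one_iff.2 h0
      constructor <;> linarith
  · intro x y
    rw [hA]
    constructor
    · intro h
      refine tendsto_of_tendsto_coeff b
        ((hasSum_norm_inner_sq b y).summable.mul_left (2 ^ 2) |>.congr fun i => by
          rw [← mul_pow]) (fun i => ?_) ?_
      · rw [h i]
        refine (((Complex.continuous_ofReal.tendsto _).comp (hquot i)).mul_const
          (inner ℂ (b i) x)).congr' ?_
        filter_upwards [self_mem_nhdsWithin] with t ht
        rw [hcoef x t ht]
        rfl
      · filter_upwards [self_mem_nhdsWithin] with t ht i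
        have ht : 0 < t := ht
        have h0 : t * d i ≤ 0 := mul_nonpos_of_nonneg_of_nonpos ht.le (hd i)
        rw [hcoef x t ht, h i, ← sub_mul, norm_mul, norm_mul, ← mul_assoc, ← Complex.ofReal_sub,
          Complex.norm_real, Complex.norm_real]
        refine mul_le_mul_of_nonneg_right ?_ (norm_nonneg _)
        rw [Real.norm_eq_abs, Real.norm_eq_abs, abs_of_nonpos (hd i), abs_le]
        have h1 := Real.add_one_le_exp (t * d i)
        have h2 := Real.exp_le_one_iff.2 h0
        have h3 : d i ≤ (Real.exp (t * d i) - 1) / t := by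
          rw [le_div_iff₀ ht]; linarith
        have h4 : (Real.exp (t * d i) - 1) / t ≤ 0 :=
          div_nonpos_of_nonpos_of_nonneg (by linarith) ht.le
        constructor <;> linarith [hd i]
    · intro h i
      refine tendsto_nhds_unique ((Continuous.tendsto (f := fun z => inner ℂ (b i) z)
        (by fun_prop) y).comp h) ?_
      refine (((Complex.continuous_ofReal.tendsto _).comp (hquot i)).mul_const
        (inner ℂ (b i) x)).congr' ?_
      filter_upwards [self_mem_nhdsWithin] with t ht
      simp only [Function.comp_apply]
      rw [hcoef x t ht]

theorem opExp_apply_of_diagonal [CompleteSpace H] {ι : Type*} (b : HilbertBasis ι ℂ H)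
    {A : H →ₗ.[ℂ] H} {d : ι → ℝ} (hd : ∀ i, d i ≤ 0)
    (hA : ∀ x y, (x, y) ∈ A.graph ↔ ∀ i, inner ℂ (b i) y = (d i : ℂ) * inner ℂ (b i) x) (i : ι) :
    opExp A (b i) = (Real.exp (d i) : ℂ) • b i := by
  classical
  have h := exists_isSemigroupOf_of_diagonal b hd hA
  rw [opExp, dif_pos h]
  refine h.choose_spec.apply_of_eigen ((hA _ _).2 fun j => ?_)
  rw [inner_smul_right, inner_basis_self]
  by_cases hji : j = i
  · rw [hji]
  · simp [hji]

end Semigroup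

section Graphs

variable {H : Type*} [NormedAddCommGroup H] [InnerProductSpace ℂ H]

theorem mem_graph_opComp {A B : H →ₗ.[ℂ] H} {x z : H} :
    (x, z) ∈ (opComp B A).graph ↔ ∃ y, (x, y) ∈ A.graph ∧ (y, z) ∈ B.graph := by
  simp only [LinearPMap.mem_graph_iff]
  constructor
  · rintro ⟨⟨u, hu⟩, rfl, hz⟩
    obtain ⟨hA, hB⟩ := (mem_opComp_domain B A _).1 hu
    exact ⟨A ⟨u, hA⟩, ⟨⟨u, hA⟩, rfl, rfl⟩, ⟨⟨_, hB⟩, rfl, hz⟩⟩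
  · rintro ⟨y, ⟨u, rfl, rfl⟩, v, hv, rfl⟩
    have hm : (u : H) ∈ (opComp B A).domain :=
      (mem_opComp_domain B A _).2 ⟨u.2, by rw [← hv]; exact v.2⟩
    refine ⟨⟨u, hm⟩, rfl, ?_⟩
    exact congrArg (fun t : B.domain => B t) (Subtype.ext hv.symm)

theorem subConst_apply {A : H →ₗ.[ℂ] H} {a : ℝ} (u : A.domain) :
    subConst A a u = A u - (a : ℂ) • (u : H) := by
  change -(a : ℂ) • (u : H) + A u = _
  rw [neg_smul, neg_add_eq_sub]

theorem mem_graph_subConst {A : H →ₗ.[ℂ] H} {a : ℝ} {x y : H} :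
    (x, y) ∈ (subConst A a).graph ↔ (x, y + (a : ℂ) • x) ∈ A.graph := by
  simp only [LinearPMap.mem_graph_iff]
  constructor
  · rintro ⟨u, rfl, rfl⟩
    refine ⟨u, rfl, ?_⟩
    exact (eq_sub_iff_add_eq.1 (subConst_apply (A := A) (a := a) u)).symm
  · rintro ⟨u, rfl, hu⟩
    refine ⟨u, rfl, ?_⟩
    exact (subConst_apply u).trans (sub_eq_of_eq_add hu)

theorem mem_graph_smul {A : H →ₗ.[ℂ] H} {c : ℂ} {x z : H} :
    (x, z) ∈ (c • A).graph ↔ ∃ y, (x, y) ∈ A.graph ∧ z = c • y := by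
  simp only [LinearPMap.mem_graph_iff]
  constructor
  · rintro ⟨u, rfl, rfl⟩
    exact ⟨A u, ⟨u, rfl, rfl⟩, rfl⟩
  · rintro ⟨y, ⟨u, rfl, rfl⟩, rfl⟩
    exact ⟨u, rfl, rfl⟩

theorem mem_graph_add {A B : H →ₗ.[ℂ] H} {x z : H} :
    (x, z) ∈ (A + B).graph ↔ ∃ y y', (x, y) ∈ A.graph ∧ (x, y') ∈ B.graph ∧ z = y + y' := by
  simp only [LinearPMap.mem_graph_iff]
  constructor
  · rintro ⟨u, rfl, rfl⟩
    exact ⟨_, _, ⟨⟨u, u.2.1⟩, rfl, rfl⟩, ⟨⟨u, u.2.2⟩, rfl, rfl⟩, rfl⟩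
  · rintro ⟨y, y', ⟨u, rfl, rfl⟩, ⟨v, hv, rfl⟩, rfl⟩
    refine ⟨⟨u, u.2, by rw [← hv]; exact v.2⟩, rfl, ?_⟩
    exact congrArg (fun t : B.domain => A u + B t) (Subtype.ext hv.symm)

end Graphs

section Indices

variable {n : ℕ}

/-- Raise the `k`-th entry of a multi-index. -/
def raise (k : Fin n) (α : Fin n → ℕ) : Fin n → ℕ := α + Pi.single k 1

/-- Lower the `k`-th entry of a multi-index (unless it is zero). -/
def lower (k : Fin n) (α : Fin n → ℕ) : Fin n → ℕ := α - Pi.single k 1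

@[simp] theorem raise_same (k : Fin n) (α : Fin n → ℕ) : raise k α k = α k + 1 := by
  simp [raise]

@[simp] theorem lower_same (k : Fin n) (α : Fin n → ℕ) : lower k α k = α k - 1 := by
  simp [lower]

theorem raise_of_ne {j k : Fin n} (h : j ≠ k) (α : Fin n → ℕ) : raise k α j = α j := by
  simp [raise, h]

@[simp] theorem lower_raise (k : Fin n) (α : Fin n → ℕ) : lower k (raise k α) = α :=
  add_tsub_cancel_right _ _

theorem raise_lower {k : Fin n} {α : Fin n → ℕ} (h : α k ≠ 0) : raise k (lower k α) = α := by
  refine tsub_add_cancel_of_le fun j => ?_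
  by_cases hj : j = k
  · subst hj; simpa [Nat.one_le_iff_ne_zero] using h
  · simp [hj]

theorem raise_injective (k : Fin n) : Function.Injective (raise k) :=
  fun α β h => by rw [← lower_raise k α, h, lower_raise]

theorem hasSum_comp_raise_iff {M : Type*} [AddCommMonoid M] [TopologicalSpace M] (k : Fin n)
    {F : (Fin n → ℕ) → M} (hF : ∀ α, α k = 0 → F α = 0) {a : M} :
    HasSum (fun α => F (raise k α)) a ↔ HasSum F a := by
  refine (raise_injective k).hasSum_iff fun α hα => hF α ?_
  by_contra h
  exact hα ⟨lower k α, raise_lower h⟩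

theorem summable_comp_raise_iff {M : Type*} [AddCommMonoid M] [TopologicalSpace M] (k : Fin n)
    {F : (Fin n → ℕ) → M} (hF : ∀ α, α k = 0 → F α = 0) :
    Summable (fun α => F (raise k α)) ↔ Summable F :=
  exists_congr fun _ => hasSum_comp_raise_iff k hF

end Indices

section Ladders

variable {H : Type*} [NormedAddCommGroup H] [InnerProductSpace ℂ H] {n : ℕ}

/-- The vector `w √(m + 1) h_{α + e_k} + w̄ √m h_{α - e_k}`, where `m = α_k`. -/
noncomputable def ladderVec (h : HilbertBasis (Fin n → ℕ) ℂ H) (k : Fin n) (w : ℂ)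
    (α : Fin n → ℕ) : H :=
  (w * (√(α k + 1 : ℝ) : ℂ)) • h (raise k α) + (star w * (√(α k : ℝ) : ℂ)) • h (lower k α)

/-- `X` is a closed symmetric operator that acts on the orthonormal basis `h` like a multiple of a
position or momentum operator acts on the states of a harmonic oscillator. -/
structure IsLadder (h : HilbertBasis (Fin n → ℕ) ℂ H) (k : Fin n) (X : H →ₗ.[ℂ] H) (w : ℂ) :
    Prop where
  closed : X.IsClosed
  symm : ∀ {x x' y y' : H}, (x, x') ∈ X.graph → (y, y') ∈ X.graph → inner ℂ x' y = inner ℂ x y'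
  basis : ∀ α, (h α, ladderVec h k w α) ∈ X.graph

variable {h : HilbertBasis (Fin n → ℕ) ℂ H} {k : Fin n} {X Y : H →ₗ.[ℂ] H} {w v : ℂ}

theorem inner_ladderVec_left (α : Fin n → ℕ) (x : H) :
    inner ℂ (ladderVec h k w α) x = star w * (√(α k + 1 : ℝ) : ℂ) * inner ℂ (h (raise k α)) x
      + w * (√(α k : ℝ) : ℂ) * inner ℂ (h (lower k α)) x := by
  rw [ladderVec, inner_add_left, inner_smul_left, inner_smul_left]
  simp

theorem IsLadder.inner_basis (hX : IsLadder h k X w) {x y : H} (hxy : (x, y) ∈ X.graph)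
    (α : Fin n → ℕ) :
    inner ℂ (h α) y = star w * (√(α k + 1 : ℝ) : ℂ) * inner ℂ (h (raise k α)) x
      + w * (√(α k : ℝ) : ℂ) * inner ℂ (h (lower k α)) x := by
  rw [← hX.symm (hX.basis α) hxy, inner_ladderVec_left]

theorem summable_smul_of_orthonormal [CompleteSpace H] {ι : Type*} {u : ι → H}
    (hu : Orthonormal ℂ u) {a : ι → ℂ} (ha : Summable fun i => ‖a i‖ ^ 2) :
    Summable fun i => a i • u i := by
  simpa using (hu.orthogonalFamily.summable_iff_norm_sq_summable a).2 ha

theorem IsLadder.exists_mem_graph [CompleteSpace H] (hX : IsLadder h k X w) {x : H}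
    (hx : Summable fun α : Fin n → ℕ => (α k + 1 : ℝ) * ‖inner ℂ (h α) x‖ ^ 2) :
    ∃ y, (x, y) ∈ X.graph := by
  have h1 : Summable fun α : Fin n → ℕ =>
      (inner ℂ (h α) x * (w * (√(α k + 1 : ℝ) : ℂ))) • h (raise k α) := by
    refine summable_smul_of_orthonormal (h.orthonormal.comp _ (raise_injective k)) ?_
    refine (hx.mul_left (‖w‖ ^ 2)).congr fun α => ?_
    rw [norm_mul, norm_mul, Complex.norm_real, Real.norm_of_nonneg (Real.sqrt_nonneg _), mul_pow,
      mul_pow, Real.sq_sqrt (by positivity)]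
    ring
  have h2 : Summable fun α : Fin n → ℕ =>
      (inner ℂ (h α) x * (star w * (√(α k : ℝ) : ℂ))) • h (lower k α) := by
    rw [← summable_comp_raise_iff k (fun α hα => by simp [hα])]
    simp only [lower_raise]
    refine summable_smul_of_orthonormal h.orthonormal ?_
    refine ((hx.comp_injective (raise_injective k)).mul_left (‖w‖ ^ 2)).of_nonneg_of_le
      (fun α => by positivity) fun α => ?_
    rw [norm_mul, norm_mul, Complex.norm_real, Real.norm_of_nonneg (Real.sqrt_nonneg _), mul_pow,
      mul_pow, Real.sq_sqrt (by positivity), norm_star, Function.comp_apply, mul_comm (_ ^ 2),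
      mul_assoc, raise_same]
    gcongr
    simp
  have h3 : Summable fun α => inner ℂ (h α) x • ladderVec h k w α := by
    refine (h1.add h2).congr fun α => ?_
    simp only [ladderVec, smul_add, smul_smul]
  obtain ⟨y, hy⟩ := h3
  have hx' : HasSum (fun α => inner ℂ (h α) x • h α) x := by
    simpa [h.repr_apply_apply] using h.hasSum_repr x
  refine ⟨y, hX.closed.mem_of_tendsto (hx'.prodMk hy) (.of_forall fun s => ?_)⟩
  exact Submodule.sum_mem _ fun α _ => Submodule.smul_mem _ (inner ℂ (h α) x) (hX.basis α)

theorem IsLadder.exists_mem_graph_sq [CompleteSpace H] (hX : IsLadder h k X w) {x : H}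
    (hx : Summable fun α : Fin n → ℕ => (α k + 1 : ℝ) ^ 2 * ‖inner ℂ (h α) x‖ ^ 2) :
    ∃ y z, (x, y) ∈ X.graph ∧ (y, z) ∈ X.graph := by
  obtain ⟨y, hy⟩ := hX.exists_mem_graph (hx.of_nonneg_of_le (fun α => by positivity) fun α => by
    gcongr
    exact le_self_pow₀ (by simp) two_ne_zero)
  have h1 : Summable fun α : Fin n → ℕ =>
      (α k + 1 : ℝ) ^ 2 * ‖inner ℂ (h (raise k α)) x‖ ^ 2 := by
    refine (hx.comp_injective (raise_injective k)).of_nonneg_of_le (fun α => by positivity)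
      fun α => ?_
    rw [Function.comp_apply, raise_same]
    gcongr
    simp
  have h2 : Summable fun α : Fin n → ℕ =>
      (α k + 1 : ℝ) * α k * ‖inner ℂ (h (lower k α)) x‖ ^ 2 := by
    rw [← summable_comp_raise_iff k (fun α hα => by simp [hα])]
    refine (hx.mul_left 2).of_nonneg_of_le (fun α => by positivity) fun α => ?_
    rw [lower_raise, raise_same, ← mul_assoc]
    refine mul_le_mul_of_nonneg_right ?_ (by positivity)
    push_cast
    nlinarith [(α k).cast_nonneg (α := ℝ)]
  obtain ⟨z, hz⟩ := hX.exists_mem_graph (x := y) <| by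
    refine ((h1.add h2).mul_left (2 * ‖w‖ ^ 2)).of_nonneg_of_le (fun α => by positivity)
      fun α => ?_
    rw [hX.inner_basis hy]
    set p := inner ℂ (h (raise k α)) x
    set q := inner ℂ (h (lower k α)) x
    have e1 : ‖star w * (√(α k + 1 : ℝ) : ℂ) * p‖ ^ 2 = ‖w‖ ^ 2 * (α k + 1 : ℝ) * ‖p‖ ^ 2 := by
      rw [norm_mul, norm_mul, Complex.norm_real, Real.norm_of_nonneg (Real.sqrt_nonneg _), mul_pow,
        mul_pow, Real.sq_sqrt (by positivity), norm_star]
    have e2 : ‖w * (√(α k : ℝ) : ℂ) * q‖ ^ 2 = ‖w‖ ^ 2 * (α k : ℝ) * ‖q‖ ^ 2 := by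
      rw [norm_mul, norm_mul, Complex.norm_real, Real.norm_of_nonneg (Real.sqrt_nonneg _), mul_pow,
        mul_pow, Real.sq_sqrt (by positivity)]
    have e3 := norm_add_le (star w * (√(α k + 1 : ℝ) : ℂ) * p) (w * (√(α k : ℝ) : ℂ) * q)
    have e4 : ‖star w * (√(α k + 1 : ℝ) : ℂ) * p + w * (√(α k : ℝ) : ℂ) * q‖ ^ 2 ≤
        2 * (‖w‖ ^ 2 * (α k + 1 : ℝ) * ‖p‖ ^ 2 + ‖w‖ ^ 2 * (α k : ℝ) * ‖q‖ ^ 2) := by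
      rw [← e1, ← e2]
      exact (pow_le_pow_left₀ (norm_nonneg _) e3 2).trans (add_sq_le)
    calc _ ≤ (α k + 1 : ℝ) * (2 * (‖w‖ ^ 2 * (α k + 1 : ℝ) * ‖p‖ ^ 2
          + ‖w‖ ^ 2 * (α k : ℝ) * ‖q‖ ^ 2)) := by gcongr
      _ = _ := by ring
  exact ⟨y, z, hy, hz⟩

theorem IsLadder.inner_basis_sq (hX : IsLadder h k X w) {x y z : H} (hxy : (x, y) ∈ X.graph)
    (hyz : (y, z) ∈ X.graph) (α : Fin n → ℕ) :
    inner ℂ (h α) z = (‖w‖ ^ 2 * (2 * α k + 1) : ℝ) * inner ℂ (h α) x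
      + w ^ 2 * ((√(α k : ℝ) * √(α k - 1 : ℝ) : ℝ) * inner ℂ (h (lower k (lower k α))) x)
      + star w ^ 2 * ((√(α k + 1 : ℝ) * √(α k + 2 : ℝ) : ℝ)
        * inner ℂ (h (raise k (raise k α))) x) := by
  have hw : w * star w = (‖w‖ ^ 2 : ℝ) := by
    push_cast
    exact Complex.mul_conj' w
  have hs1 : ((√(α k + 1 : ℝ) : ℝ) : ℂ) * (√(α k + 1 : ℝ) : ℝ) = (α k + 1 : ℝ) := by
    rw [← Complex.ofReal_mul, Real.mul_self_sqrt (by positivity)]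
  rw [hX.inner_basis hyz, hX.inner_basis hxy, hX.inner_basis hxy, raise_same, lower_raise,
    lower_same]
  have hadd : √(((α k + 1 : ℕ) : ℝ) + 1) = √(α k + 2 : ℝ) := by
    congr 1; push_cast; ring
  rw [hadd, Nat.cast_succ]
  rcases Nat.eq_zero_or_pos (α k) with h0 | h0
  · simp only [h0]
    simp
    push_cast [RCLike.star_def] at hw
    linear_combination (inner ℂ (h α) x) * hw
  · rw [raise_lower h0.ne', Nat.cast_sub h0, Nat.cast_one, sub_add_cancel]
    have hs0 : ((√(α k : ℝ) : ℝ) : ℂ) * (√(α k : ℝ) : ℝ) = (α k : ℝ) := by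
      rw [← Complex.ofReal_mul, Real.mul_self_sqrt (by positivity)]
    push_cast at hs0 hs1 hw ⊢
    linear_combination (inner ℂ (h α) x) * (w * star w) * (hs0 + hs1)
      + (inner ℂ (h α) x) * (2 * α k + 1) * hw

/-- The energy of two ladder operators of opposite phase is exactly the diagonal operator on its
maximal domain. -/
theorem IsLadder.mem_graph_energy [CompleteSpace H] (hX : IsLadder h k X w) (hY : IsLadder h k Y v)
    {a b l : ℝ} (hl : 0 < l) (h0 : (a : ℂ) * w ^ 2 + b * v ^ 2 = 0)
    (h1 : a * ‖w‖ ^ 2 + b * ‖v‖ ^ 2 = l) (x y : H) :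
    (x, y) ∈ ((a : ℂ) • opComp X X + (b : ℂ) • opComp Y Y).graph ↔
      ∀ α, inner ℂ (h α) y = (l * (2 * α k + 1) : ℝ) * inner ℂ (h α) x := by
  have h0' : (a : ℂ) * star w ^ 2 + b * star v ^ 2 = 0 := by
    have := congrArg star h0
    simpa using this
  have forward : ∀ y, (x, y) ∈ ((a : ℂ) • opComp X X + (b : ℂ) • opComp Y Y).graph →
      ∀ α, inner ℂ (h α) y = (l * (2 * α k + 1) : ℝ) * inner ℂ (h α) x := by
    intro y hy α
    obtain ⟨_, _, hau, hbu, rfl⟩ := mem_graph_add.1 hy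
    obtain ⟨u, hu, rfl⟩ := mem_graph_smul.1 hau
    obtain ⟨u', hu', rfl⟩ := mem_graph_smul.1 hbu
    obtain ⟨p, hp, hpu⟩ := mem_graph_opComp.1 hu
    obtain ⟨q, hq, hqu⟩ := mem_graph_opComp.1 hu'
    rw [inner_add_right, inner_smul_right, inner_smul_right, hX.inner_basis_sq hp hpu,
      hY.inner_basis_sq hq hqu, ← h1]
    push_cast
    linear_combination (√(α k : ℝ) * √(α k - 1 : ℝ)
      * inner ℂ (h (lower k (lower k α))) x) * h0 + (√(α k + 1 : ℝ) * √(α k + 2 : ℝ)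
      * inner ℂ (h (raise k (raise k α))) x) * h0'
  refine ⟨forward y, fun hy => ?_⟩
  have hs : Summable fun α : Fin n → ℕ => (α k + 1 : ℝ) ^ 2 * ‖inner ℂ (h α) x‖ ^ 2 := by
    refine ((hasSum_norm_inner_sq h y).summable.mul_left (1 / l ^ 2)).of_nonneg_of_le
      (fun α => by positivity) fun α => ?_
    rw [hy α, norm_mul, Complex.norm_real, Real.norm_of_nonneg (by positivity), mul_pow, mul_pow,
      ← mul_assoc, ← mul_assoc, one_div, inv_mul_cancel₀ (by positivity), one_mul]
    gcongr
    linarith [(α k).cast_nonneg (α := ℝ)]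
  obtain ⟨p, u, hp, hu⟩ := hX.exists_mem_graph_sq hs
  obtain ⟨q, u', hq, hu'⟩ := hY.exists_mem_graph_sq hs
  have hmem : (x, (a : ℂ) • u + (b : ℂ) • u') ∈
      ((a : ℂ) • opComp X X + (b : ℂ) • opComp Y Y).graph :=
    mem_graph_add.2 ⟨_, _, mem_graph_smul.2 ⟨_, mem_graph_opComp.2 ⟨p, hp, hu⟩, rfl⟩,
      mem_graph_smul.2 ⟨_, mem_graph_opComp.2 ⟨q, hq, hu'⟩, rfl⟩, rfl⟩
  rwa [eq_of_inner_basis h fun α => (hy α).trans (forward _ hmem α).symm]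

theorem norm_smul_add_star_smul_sq (w : ℂ) (p q : H) :
    ‖w • p + star w • q‖ ^ 2 = ‖w‖ ^ 2 * (‖p‖ ^ 2 + ‖q‖ ^ 2)
      + 2 * (star w ^ 2 * inner ℂ p q).re := by
  rw [norm_add_sq (𝕜 := ℂ), norm_smul, norm_smul, norm_star, inner_smul_left, inner_smul_right]
  simp only [RCLike.re_to_complex, RCLike.star_def]
  ring_nf

theorem norm_sqrt_smul_sq {r : ℝ} (hr : 0 ≤ r) (x : H) : ‖(√r : ℂ) • x‖ ^ 2 = r * ‖x‖ ^ 2 := by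
  rw [norm_smul, mul_pow, Complex.norm_real, Real.norm_of_nonneg (Real.sqrt_nonneg _),
    Real.sq_sqrt hr]

theorem norm_ladderVec_add_smul_sq (α : Fin n → ℕ) (c : ℝ) :
    ‖ladderVec h k w α + (c : ℂ) • h α‖ ^ 2 = ‖w‖ ^ 2 * (2 * α k + 1) + c ^ 2 := by
  have hne1 : raise k α ≠ α := fun e => by simpa using congrFun e k
  have i1 : inner ℂ (h (raise k α)) (h α) = 0 := h.orthonormal.2 hne1
  have i2 : (√(α k : ℝ) : ℂ) * inner ℂ (h (lower k α)) (h α) = 0 := by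
    rcases Nat.eq_zero_or_pos (α k) with h0 | h0
    · simp [h0]
    · have hne : lower k α ≠ α := fun e => by
        have := congrFun e k
        rw [lower_same] at this
        omega
      rw [h.orthonormal.2 hne, mul_zero]
  have i3 : (√(α k : ℝ) : ℂ) * inner ℂ (h (raise k α)) (h (lower k α)) = 0 := by
    have hne : raise k α ≠ lower k α := fun e => by
      have := congrFun e k
      rw [lower_same, raise_same] at this
      omega
    rw [h.orthonormal.2 hne, mul_zero]
  have e1 : inner ℂ (ladderVec h k w α) ((c : ℂ) • h α) = 0 := by
    rw [inner_smul_right, inner_ladderVec_left, i1, mul_zero, zero_add, mul_assoc, i2, mul_zero,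
      mul_zero]
  have e2 : ‖ladderVec h k w α‖ ^ 2 = ‖w‖ ^ 2 * (2 * α k + 1) := by
    have : ladderVec h k w α = w • ((√(α k + 1 : ℝ) : ℂ) • h (raise k α)) +
      star w • ((√(α k : ℝ) : ℂ) • h (lower k α)) := by
      simp only [ladderVec, smul_smul]
    rw [this, norm_smul_add_star_smul_sq, norm_sqrt_smul_sq (by positivity),
      norm_sqrt_smul_sq (by positivity), norm_basis, norm_basis, inner_smul_left,
      inner_smul_right, i3, mul_zero, mul_zero, Complex.zero_re]
    ring
  rw [norm_add_sq (𝕜 := ℂ), e1, e2, norm_smul, norm_basis, Complex.norm_real]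
  simp

end Ladders

section Positive

variable {H : Type*} [NormedAddCommGroup H] [InnerProductSpace ℂ H] [CompleteSpace H]
variable {σ : H →L[ℂ] H}

theorem sqrtOp_isSelfAdjoint (σ : H →L[ℂ] H) : IsSelfAdjoint (sqrtOp σ) :=
  (IsSelfAdjoint.of_nonneg (cfc_nonneg fun x _ => Real.sqrt_nonneg x))

theorem inner_sqrtOp (σ : H →L[ℂ] H) (x y : H) :
    inner ℂ (sqrtOp σ x) y = inner ℂ x (sqrtOp σ y) :=
  (sqrtOp_isSelfAdjoint σ).isSymmetric x y

theorem spectrum_nonneg_of_isPositive (hσ : σ.IsPositive) {s : ℝ} (hs : s ∈ spectrum ℝ σ) :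
    0 ≤ s :=
  spectrum_nonneg_of_nonneg ((ContinuousLinearMap.nonneg_iff_isPositive σ).2 hσ) hs

theorem sqrtOp_mul_sqrtOp (hσ : σ.IsPositive) : sqrtOp σ * sqrtOp σ = σ := by
  rw [sqrtOp, ← cfc_mul Real.sqrt Real.sqrt σ]
  conv_rhs => rw [← cfc_id ℝ σ hσ.isSelfAdjoint]
  exact cfc_congr fun s hs => Real.mul_self_sqrt (spectrum_nonneg_of_isPositive hσ hs)

theorem inner_apply_eq_norm_sqrtOp_sq (hσ : σ.IsPositive) (x : H) :
    inner ℂ x (σ x) = ((‖sqrtOp σ x‖ ^ 2 : ℝ) : ℂ) := by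
  conv_lhs => rw [← sqrtOp_mul_sqrtOp hσ]
  rw [mul_apply_eq_comp, ← inner_sqrtOp, inner_self_eq_norm_sq_to_K]
  norm_cast

theorem hasSum_of_tsum_ofReal_eq {ι κ : Type*} {f : ι → ℝ} {g : κ → ℝ} (hf : ∀ i, 0 ≤ f i)
    (hg : ∀ i, 0 ≤ g i) (e : ∑' i, ENNReal.ofReal (g i) = ∑' i, ENNReal.ofReal (f i)) {s : ℝ}
    (hs : HasSum f s) : HasSum g s := by
  rw [← ENNReal.ofReal_tsum_of_nonneg hf hs.summable, hs.tsum_eq] at e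
  have hsum : Summable g := by
    refine (ENNReal.summable_toReal (e ▸ ENNReal.ofReal_ne_top)).congr fun i => ?_
    rw [ENNReal.toReal_ofReal (hg i)]
  rw [← ENNReal.ofReal_tsum_of_nonneg hg hsum] at e
  exact (ENNReal.ofReal_eq_ofReal_iff (tsum_nonneg hg) (hs.nonneg hf)).1 e ▸ hsum.hasSum

/-- The trace of a positive operator may be computed in any orthonormal basis. -/
theorem posTrace_eq_tsum {ι : Type*} (h : HilbertBasis ι ℂ H) (hσ : σ.IsPositive) :
    posTrace σ = ∑' i, ENNReal.ofReal (inner ℂ (h i) (σ (h i))).re := by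
  simp only [posTrace, inner_apply_eq_norm_sqrtOp_sq hσ, Complex.ofReal_re]
  rw [tsum_enorm_sq_eq_of_formalAdjoint h (someBasis H) fun i x =>
    (inner_sqrtOp σ (h i) x).symm]

theorem hasTrace_iff_of_isPositive (hσ : σ.IsPositive) {ι : Type*} (h : HilbertBasis ι ℂ H)
    {z : ℝ} : HasTrace σ z ↔ HasSum (fun i => ‖sqrtOp σ (h i)‖ ^ 2) z := by
  simp only [HasTrace, inner_apply_eq_norm_sqrtOp_sq hσ, Complex.hasSum_ofReal]
  constructor
  · intro H1
    exact hasSum_norm_sq_of_formalAdjoint (someBasis H) (fun i x => (inner_sqrtOp σ _ x).symm)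
      (H1 _ (someBasis H)) h
  · intro H1 s b
    exact hasSum_norm_sq_of_formalAdjoint h (fun i x => (inner_sqrtOp σ _ x).symm) H1 b

theorem IsState.hasSum_norm_sqrtOp_sq (hσ : IsState σ) {ι : Type*} (h : HilbertBasis ι ℂ H) :
    HasSum (fun i => ‖sqrtOp σ (h i)‖ ^ 2) 1 :=
  (hasTrace_iff_of_isPositive hσ.pos h).1 (by simpa using hσ.trace)

theorem IsState.norm_sqrtOp_le (hσ : IsState σ) (x : H) : ‖sqrtOp σ x‖ ≤ ‖x‖ := by
  rcases eq_or_ne x 0 with rfl | hx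
  · simp
  set u : H := (‖x‖ : ℂ)⁻¹ • x with hu
  have hu1 : ‖u‖ = 1 := by
    rw [hu, norm_smul, norm_inv, Complex.norm_real, norm_norm,
      inv_mul_cancel₀ (norm_ne_zero_iff.2 hx)]
  have ho : Orthonormal ℂ ((↑) : ({u} : Set H) → H) := by
    refine ⟨fun i => ?_, fun i j hij => ?_⟩
    · rw [Set.mem_singleton_iff.1 i.2, hu1]
    · exact absurd (Subsingleton.elim i j) hij
  obtain ⟨w, b, hw, hb⟩ := ho.exists_hilbertBasis_extension
  have h1 := le_hasSum (hσ.hasSum_norm_sqrtOp_sq b) ⟨u, hw rfl⟩ fun _ _ => by positivity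
  rw [hb] at h1
  have h2 : ‖sqrtOp σ u‖ ≤ 1 := (sq_le_one_iff₀ (norm_nonneg _)).1 h1
  have e : x = (‖x‖ : ℂ) • u := by
    rw [hu, smul_smul, mul_inv_cancel₀ (by simpa using hx), one_smul]
  conv_lhs => rw [e]
  rw [map_smul, norm_smul, Complex.norm_real, norm_norm]
  exact mul_le_of_le_one_right (norm_nonneg _) h2

theorem IsState.spectrum_le_one (hσ : IsState σ) {s : ℝ} (hs : s ∈ spectrum ℝ σ) : s ≤ 1 := by
  have h1 : ‖sqrtOp σ‖ ≤ 1 := ContinuousLinearMap.opNorm_le_bound _ zero_le_one fun x => by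
    simpa using hσ.norm_sqrtOp_le x
  have h2 : ‖σ‖ ≤ 1 := by
    rw [← sqrtOp_mul_sqrtOp hσ.pos]
    exact (norm_mul_le _ _).trans (mul_le_one₀ h1 (norm_nonneg _) h1)
  rcases subsingleton_or_nontrivial H with hH | hH
  · exact absurd hs (by rw [spectrum.of_subsingleton]; simp)
  · exact (le_abs_self s).trans ((spectrum.norm_le_norm_of_mem hs).trans h2)

theorem IsState.negMulLog_isPositive (hσ : IsState σ) : (cfc Real.negMulLog σ).IsPositive :=
  (ContinuousLinearMap.nonneg_iff_isPositive _).1 <| cfc_nonneg fun _ hs =>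
    Real.negMulLog_nonneg (spectrum_nonneg_of_isPositive hσ.pos hs) (hσ.spectrum_le_one hs)

theorem negMulLog_add_sq_le {s t : ℝ} (hs : 0 ≤ s) (ht : 0 < t) :
    Real.negMulLog s + (√s - √t) * (√s - √t) ≤ (-Real.log t - 1) * s + t := by
  rcases hs.eq_or_lt with rfl | hs
  · simp [Real.mul_self_sqrt ht.le]
  have h1 := Real.log_le_sub_one_of_pos (Real.sqrt_pos.2 (div_pos ht hs))
  rw [Real.log_sqrt (div_pos ht hs).le, Real.log_div ht.ne' hs.ne', Real.sqrt_div ht.le] at h1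
  have h2 : √s * √s = s := Real.mul_self_sqrt hs.le
  have h3 : √t * √t = t := Real.mul_self_sqrt ht.le
  have h4 : √t / √s * s = √t * √s := by
    rw [div_mul_eq_mul_div, div_eq_iff (Real.sqrt_pos.2 hs).ne']
    linear_combination -√t * h2
  rw [Real.negMulLog]
  nlinarith [mul_le_mul_of_nonneg_right h1 hs.le]

/-- The tangent inequality for the entropy function at the level `t`, with a quadratic remainder. -/
theorem inner_negMulLog_add_le (hσ : σ.IsPositive) {t : ℝ} (ht : 0 < t) (x : H) :
    (inner ℂ x (cfc Real.negMulLog σ x)).re + ‖sqrtOp σ x - (√t : ℂ) • x‖ ^ 2 ≤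
      (-Real.log t - 1) * ‖sqrtOp σ x‖ ^ 2 + t * ‖x‖ ^ 2 := by
  have hsa := hσ.isSelfAdjoint
  have h1 : cfc (fun s => Real.negMulLog s + (√s - √t) * (√s - √t)) σ ≤
      cfc (fun s => (-Real.log t - 1) * s + t) σ :=
    cfc_mono fun s hs => negMulLog_add_sq_le (spectrum_nonneg_of_isPositive hσ hs) ht
  have h2 : cfc (fun s => √s - √t) σ = sqrtOp σ - algebraMap ℝ _ (√t) := by
    rw [cfc_sub (a := σ) Real.sqrt (fun _ => √t), cfc_const _ σ, sqrtOp]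
  rw [cfc_add (a := σ) Real.negMulLog (fun s => (√s - √t) * (√s - √t))
      Real.continuous_negMulLog.continuousOn,
    cfc_mul (fun s => √s - √t) (fun s => √s - √t), cfc_add (a := σ) (fun s => (-Real.log t - 1) * s)
      (fun _ => t), cfc_const _ σ, cfc_const_mul_id _ σ, h2] at h1
  have h3 := ((ContinuousLinearMap.le_def _ _).1 h1).re_inner_nonneg_right x
  have h4 : inner ℂ x (((sqrtOp σ - algebraMap ℝ (H →L[ℂ] H) (√t)) *
      (sqrtOp σ - algebraMap ℝ (H →L[ℂ] H) (√t))) x) =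
      ((‖sqrtOp σ x - (√t : ℂ) • x‖ ^ 2 : ℝ) : ℂ) := by
    have e : ∀ y, (sqrtOp σ - algebraMap ℝ (H →L[ℂ] H) (√t)) y = sqrtOp σ y - (√t : ℂ) • y := by
      intro y
      simp [Algebra.algebraMap_eq_smul_one]
    have hs : IsSelfAdjoint (sqrtOp σ - algebraMap ℝ (H →L[ℂ] H) (√t)) :=
      (sqrtOp_isSelfAdjoint σ).sub (IsSelfAdjoint.algebraMap _ (.all _))
    rw [mul_apply_eq_comp, ← e, Complex.ofReal_pow]
    exact (hs.isSymmetric x _).symm.trans (inner_self_eq_norm_sq_to_K _)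
  have h5 : inner ℂ x (((-Real.log t - 1) • σ + algebraMap ℝ (H →L[ℂ] H) t) x) =
      (((-Real.log t - 1) * ‖sqrtOp σ x‖ ^ 2 + t * ‖x‖ ^ 2 : ℝ) : ℂ) := by
    rw [add_apply, inner_add_right, smul_apply, ← Complex.coe_smul, inner_smul_right,
      inner_apply_eq_norm_sqrtOp_sq hσ, Algebra.algebraMap_eq_smul_one, smul_apply,
      one_apply_eq_self, ← Complex.coe_smul, inner_smul_right, inner_self_eq_norm_sq_to_K]
    push_cast
    rfl
  rw [sub_apply, inner_sub_right, h5, add_apply, inner_add_right, h4, map_sub, map_add] at h3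
  simp only [RCLike.re_to_complex, Complex.ofReal_re] at h3
  linarith

end Positive

section Moments

variable {H : Type*} [NormedAddCommGroup H] [InnerProductSpace ℂ H] [CompleteSpace H] {n : ℕ}
variable {σ : H →L[ℂ] H} {h : HilbertBasis (Fin n → ℕ) ℂ H} {k : Fin n}
variable {A B : H →ₗ.[ℂ] H} {w v : ℂ} {a b s t : ℝ}

theorem HasMeanStd.mem_graph (hσ : HasMeanStd σ A a s) (x : H) :
    (sqrtOp σ x, A ⟨sqrtOp σ x, hσ.mem x⟩ - (a : ℂ) • sqrtOp σ x) ∈ (subConst A a).graph := by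
  rw [mem_graph_subConst, sub_add_cancel]
  exact A.mem_graph ⟨_, hσ.mem x⟩

theorem IsLadder.inner_sqrtOp_ladderVec {X : H →ₗ.[ℂ] H} (hX : IsLadder h k X w) {x y : H}
    (hxy : (sqrtOp σ x, y) ∈ X.graph) (α : Fin n → ℕ) :
    inner ℂ (h α) y = inner ℂ (sqrtOp σ (ladderVec h k w α)) x := by
  rw [← hX.symm (hX.basis α) hxy, inner_sqrtOp]

/-- The variance of an observable, computed in the basis on which it acts as a ladder operator. -/
theorem IsLadder.hasSum_of_hasMeanStd (hX : IsLadder h k (subConst A a) w)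
    (hσ : HasMeanStd σ A a s) :
    HasSum (fun α => ‖sqrtOp σ (ladderVec h k w α)‖ ^ 2) (s ^ 2) := by
  refine hasSum_of_tsum_ofReal_eq (fun _ => by positivity) (fun _ => by positivity) ?_
    (hσ.var _ (someBasis H))
  exact (tsum_enorm_sq_eq_of_formalAdjoint h (someBasis H)
    fun α x => hX.inner_sqrtOp_ladderVec (hσ.mem_graph x) α).symm

theorem sqrtOp_ladderVec (α : Fin n → ℕ) : sqrtOp σ (ladderVec h k w α) =
    w • ((√(α k + 1 : ℝ) : ℂ) • sqrtOp σ (h (raise k α))) +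
      star w • ((√(α k : ℝ) : ℂ) • sqrtOp σ (h (lower k α))) := by
  simp only [ladderVec, map_add, map_smul, smul_smul]

/-- Two variances determine the average of the number operator. -/
theorem hasSum_number_of_hasMeanStd (hX : IsLadder h k (subConst A a) w)
    (hY : IsLadder h k (subConst B b) v) {c d l : ℝ} (hl : 0 < l)
    (h0 : (c : ℂ) * w ^ 2 + d * v ^ 2 = 0) (h1 : c * ‖w‖ ^ 2 + d * ‖v‖ ^ 2 = l)
    (hA : HasMeanStd σ A a s) (hB : HasMeanStd σ B b t) :
    HasSum (fun α : Fin n → ℕ => (2 * α k + 1 : ℝ) * ‖sqrtOp σ (h α)‖ ^ 2)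
      ((c * s ^ 2 + d * t ^ 2) / l) := by
  have h0' : (c : ℂ) * star w ^ 2 + d * star v ^ 2 = 0 := by
    have := congrArg star h0
    simpa using this
  have hG := (((hX.hasSum_of_hasMeanStd hA).mul_left c).add
    ((hY.hasSum_of_hasMeanStd hB).mul_left d)).div_const l
  have e : ∀ α : Fin n → ℕ, (c * ‖sqrtOp σ (ladderVec h k w α)‖ ^ 2
      + d * ‖sqrtOp σ (ladderVec h k v α)‖ ^ 2) / l =
      (α k + 1 : ℝ) * ‖sqrtOp σ (h (raise k α))‖ ^ 2
        + (α k : ℝ) * ‖sqrtOp σ (h (lower k α))‖ ^ 2 := by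
    intro α
    rw [div_eq_iff hl.ne', sqrtOp_ladderVec, sqrtOp_ladderVec, norm_smul_add_star_smul_sq,
      norm_smul_add_star_smul_sq, norm_sqrt_smul_sq (by positivity),
      norm_sqrt_smul_sq (by positivity)]
    set z := inner ℂ ((√(α k + 1 : ℝ) : ℂ) • sqrtOp σ (h (raise k α)))
      ((√(α k : ℝ) : ℂ) • sqrtOp σ (h (lower k α)))
    have hz : c * (star w ^ 2 * z).re + d * (star v ^ 2 * z).re = 0 := by
      rw [← Complex.re_ofReal_mul, ← Complex.re_ofReal_mul, ← Complex.add_re, ← mul_assoc,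
        ← mul_assoc, ← add_mul, h0', zero_mul, Complex.zero_re]
    rw [← h1]
    linear_combination 2 * hz
  simp only [e] at hG
  have hs1 : Summable fun α : Fin n → ℕ => (α k + 1 : ℝ) * ‖sqrtOp σ (h (raise k α))‖ ^ 2 :=
    hG.summable.of_nonneg_of_le (fun _ => by positivity)
      fun _ => le_add_of_nonneg_right (by positivity)
  have hs2 : Summable fun α : Fin n → ℕ => (α k : ℝ) * ‖sqrtOp σ (h (lower k α))‖ ^ 2 :=
    hG.summable.of_nonneg_of_le (fun _ => by positivity)
      fun _ => le_add_of_nonneg_left (by positivity)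
  obtain ⟨S1, hS1⟩ := hs1
  obtain ⟨S2, hS2⟩ := hs2
  rw [hG.unique (hS1.add hS2)]
  have h3 : HasSum (fun α : Fin n → ℕ => (α k : ℝ) * ‖sqrtOp σ (h α)‖ ^ 2) S1 :=
    (hasSum_comp_raise_iff k fun α hα => by simp [hα]).1 (by simpa using hS1)
  have h4 : HasSum (fun α : Fin n → ℕ => (α k + 1 : ℝ) * ‖sqrtOp σ (h α)‖ ^ 2) S2 := by
    simpa using (hasSum_comp_raise_iff k fun α hα => by simp [hα]).2 hS2
  refine (h3.add h4).congr_fun fun α => ?_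
  ring

end Moments

section Diagonal

variable {H : Type*} [NormedAddCommGroup H] [InnerProductSpace ℂ H] [CompleteSpace H]
variable {ι : Type*} {h : HilbertBasis ι ℂ H} {T : H →L[ℂ] H} {t : ι → ℝ}

theorem isPositive_of_eigen (hT : ∀ i, T (h i) = (t i : ℂ) • h i) (ht : ∀ i, 0 ≤ t i) :
    T.IsPositive := by
  have hc := inner_basis_apply_of_eigen h hT
  have key : ∀ x y, HasSum (fun i => (t i : ℂ) * (inner ℂ x (h i) * inner ℂ (h i) y))
      (inner ℂ x (T y)) := fun x y => by
    refine (h.hasSum_inner_mul_inner x (T y)).congr_fun fun i => ?_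
    rw [hc]
    ring
  refine ⟨fun x y => (key x y).unique ?_ |>.symm, fun x => ?_⟩
  · have := (key y x).star
    rw [RCLike.star_def, inner_conj_symm] at this
    refine this.congr_fun fun i => ?_
    simp only [map_mul, inner_conj_symm, Complex.conj_ofReal]
    ring
  · have := Complex.hasSum_re (key x x)
    rw [ContinuousLinearMap.reApplyInnerSelf_apply, ← inner_re_symm]
    refine this.nonneg fun i => ?_
    rw [← inner_conj_symm x (h i), Complex.conj_mul', ← Complex.ofReal_pow, ← Complex.ofReal_mul,
      Complex.ofReal_re]
    exact mul_nonneg (ht i) (by positivity)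

theorem sqrtOp_apply_of_eigen (hT : ∀ i, T (h i) = (t i : ℂ) • h i) (ht : ∀ i, 0 ≤ t i) (i : ι) :
    sqrtOp T (h i) = (√(t i) : ℂ) • h i :=
  cfc_apply_of_eigen (isPositive_of_eigen hT ht).isSelfAdjoint Real.continuous_sqrt.continuousOn
    (hT i)

theorem norm_sqrtOp_of_eigen (hT : ∀ i, T (h i) = (t i : ℂ) • h i) (ht : ∀ i, 0 ≤ t i) (i : ι) :
    ‖sqrtOp T (h i)‖ ^ 2 = t i := by
  rw [sqrtOp_apply_of_eigen hT ht, norm_sqrt_smul_sq (ht i), norm_basis, one_pow, mul_one]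

theorem isState_of_eigen (hT : ∀ i, T (h i) = (t i : ℂ) • h i) (ht : ∀ i, 0 ≤ t i)
    (hsum : HasSum t 1) : IsState T := by
  have hpos := isPositive_of_eigen hT ht
  refine ⟨hpos, ?_⟩
  rw [← Complex.ofReal_one, hasTrace_iff_of_isPositive hpos h]
  simpa only [norm_sqrtOp_of_eigen hT ht] using hsum

theorem vonNeumannEntropy_of_eigen (hT : ∀ i, T (h i) = (t i : ℂ) • h i) (ht : ∀ i, 0 ≤ t i)
    (hsum : HasSum t 1) :
    vonNeumannEntropy T = ∑' i, ENNReal.ofReal (Real.negMulLog (t i)) := by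
  have hst := isState_of_eigen hT ht hsum
  rw [vonNeumannEntropy, posTrace_eq_tsum h hst.negMulLog_isPositive]
  congr with i
  rw [cfc_apply_of_eigen hst.pos.isSelfAdjoint Real.continuous_negMulLog.continuousOn (hT i),
    inner_smul_right, inner_self_eq_norm_sq_to_K, norm_basis]
  simp

end Diagonal

section DiagonalMoments

variable {H : Type*} [NormedAddCommGroup H] [InnerProductSpace ℂ H] [CompleteSpace H] {n : ℕ}
variable {h : HilbertBasis (Fin n → ℕ) ℂ H} {k : Fin n} {A : H →ₗ.[ℂ] H} {w : ℂ} {a s : ℝ}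
variable {T : H →L[ℂ] H} {t : (Fin n → ℕ) → ℝ}

theorem IsLadder.hasMeanStd_of_eigen (hX : IsLadder h k (subConst A a) w)
    (hT : ∀ α, T (h α) = (t α : ℂ) • h α) (ht : ∀ α, 0 ≤ t α) (hsum : HasSum t 1)
    (hvar : HasSum (fun α : Fin n → ℕ => ‖w‖ ^ 2 * ((2 * α k + 1 : ℝ) * t α)) (s ^ 2))
    (hw : w ≠ 0) : HasMeanStd T A a s := by
  set R := sqrtOp T with hR
  have hst := isState_of_eigen hT ht hsum
  have hRh : ∀ α, R (h α) = (√(t α) : ℂ) • h α := sqrtOp_apply_of_eigen hT ht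
  have hRc := inner_basis_apply_of_eigen h hRh
  have hmem : ∀ x, ∃ y, (R x, y) ∈ (subConst A a).graph := fun x => by
    refine hX.exists_mem_graph ?_
    have hw2 : 0 < ‖w‖ ^ 2 := by positivity
    refine ((hasSum_norm_inner_sq h x).summable.mul_left (s ^ 2 / ‖w‖ ^ 2)).of_nonneg_of_le
      (fun _ => by positivity) fun α => ?_
    have hle := le_hasSum hvar α fun β _ => mul_nonneg hw2.le (mul_nonneg (by positivity) (ht β))
    rw [hRc, norm_mul, mul_pow, Complex.norm_real, Real.norm_of_nonneg (Real.sqrt_nonneg _),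
      Real.sq_sqrt (ht α), ← mul_assoc]
    refine mul_le_mul_of_nonneg_right ?_ (by positivity)
    rw [le_div_iff₀ hw2]
    nlinarith [mul_nonneg hw2.le (mul_nonneg (α k).cast_nonneg (ht α))]
  have hdom : ∀ x, R x ∈ A.domain := fun x => by
    obtain ⟨y, hy⟩ := hmem x
    exact A.mem_domain_of_mem_graph (mem_graph_subConst.1 hy)
  set X : H → H := fun x => A ⟨R x, hdom x⟩ - (a : ℂ) • R x with hXdef
  have hXg : ∀ x, (R x, X x) ∈ (subConst A a).graph := fun x => by
    rw [mem_graph_subConst, sub_add_cancel]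
    exact A.mem_graph ⟨_, hdom x⟩
  have hXh : ∀ α, X (h α) = (√(t α) : ℂ) • ladderVec h k w α := fun α => by
    refine LinearPMap.mem_graph_snd_inj _ (hXg (h α)) (Submodule.smul_mem _ _ (hX.basis α)) ?_
    exact hRh α
  have hshift : ∀ (c : ℝ) (τ : Set H) (b : HilbertBasis τ ℂ H),
      HasSum (fun i => ‖X (b i) + (c : ℂ) • R (b i)‖ ^ 2) (s ^ 2 + c ^ 2 * 1) := by
    intro c τ b
    refine hasSum_norm_sq_of_formalAdjoint h (B := fun x => X x + (c : ℂ) • R x)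
      (B' := fun α => R (ladderVec h k w α) + (c : ℂ) • R (h α)) (fun α x => ?_) ?_ b
    · rw [inner_add_right, inner_add_left, hX.inner_sqrtOp_ladderVec (hXg x), inner_smul_right,
        inner_smul_left, Complex.conj_ofReal, inner_sqrtOp T (h α)]
    · refine (hvar.add (hsum.mul_left (c ^ 2))).congr_fun fun α => ?_
      rw [hXh, hRh, smul_comm (c : ℂ), ← smul_add, norm_sqrt_smul_sq (ht α),
        norm_ladderVec_add_smul_sq]
      ring
  refine ⟨hdom, fun τ b => ?_, fun τ b => ?_⟩
  · have h1 := ((hshift 1 τ b).sub (hshift (-1) τ b)).div_const 4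
    have h2 := (hst.hasSum_norm_sqrtOp_sq b).mul_left a
    have h3 := (Complex.hasSum_ofReal).2 (h1.add h2)
    convert! h3 using 1
    · ext i
      have hreal : ((inner ℂ (X (b i)) (R (b i))).re : ℂ) = inner ℂ (R (b i)) (X (b i)) := by
        have h5 := hX.symm (hXg (b i)) (hXg (b i))
        rw [← h5]
        refine Complex.conj_eq_iff_re.1 ?_
        rw [inner_conj_symm, h5]
      have e : A ⟨R (b i), hdom (b i)⟩ = X (b i) + (a : ℂ) • R (b i) := by
        rw [hXdef]; simp
      rw [← inner_sqrtOp, e, inner_add_right, inner_smul_right, ← hreal,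
        inner_self_eq_norm_sq_to_K, norm_add_sq (𝕜 := ℂ), norm_add_sq (𝕜 := ℂ), inner_smul_right,
        inner_smul_right]
      simp only [norm_smul, Complex.norm_real]
      simp
      ring
    · simp
  · have := hshift 0 τ b
    simp only [Complex.ofReal_zero, zero_smul, add_zero, zero_pow two_ne_zero, zero_mul] at this
    exact this

end DiagonalMoments

section Entropy

variable {H : Type*} [NormedAddCommGroup H] [InnerProductSpace ℂ H] [CompleteSpace H]
variable {ι : Type*} {h : HilbertBasis ι ℂ H} {σ T : H →L[ℂ] H} {t : ι → ℝ} {C : ℝ}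

theorem eq_of_eigen (hT : ∀ i, T (h i) = (t i : ℂ) • h i)
    (hσ : ∀ i, σ (h i) = (t i : ℂ) • h i) : σ = T := by
  ext x
  exact eq_of_inner_basis h fun i => by
    rw [inner_basis_apply_of_eigen h hT, inner_basis_apply_of_eigen h hσ]

/-- The entropy of a Gibbs state bounds the entropy of all states with the same average of the
modular Hamiltonian `-ln T`, and it is attained by no other state. -/
theorem IsState.entropy_le_and_eq (hσ : IsState σ) (hT : ∀ i, T (h i) = (t i : ℂ) • h i)
    (ht : ∀ i, 0 < t i) (hsum : HasSum t 1)
    (hC : HasSum (fun i => -Real.log (t i) * t i) C)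
    (hσC : HasSum (fun i => -Real.log (t i) * ‖sqrtOp σ (h i)‖ ^ 2) C) :
    vonNeumannEntropy σ ≤ vonNeumannEntropy T ∧
      (vonNeumannEntropy T ≤ vonNeumannEntropy σ → σ = T) := by
  have ht0 : ∀ i, 0 ≤ t i := fun i => (ht i).le
  have ht1 : ∀ i, t i ≤ 1 := fun i => le_hasSum hsum i fun j _ => ht0 j
  have hST : vonNeumannEntropy T = ENNReal.ofReal C := by
    rw [vonNeumannEntropy_of_eigen hT ht0 hsum, ← hC.tsum_eq,
      ENNReal.ofReal_tsum_of_nonneg (fun i => ?_) hC.summable]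
    · congr with i
      rw [Real.negMulLog]
      congr 1
      ring
    · exact mul_nonneg (neg_nonneg.2 (Real.log_nonpos (ht0 i) (ht1 i))) (ht0 i)
  set c : ι → ℝ := fun i => (inner ℂ (h i) (cfc Real.negMulLog σ (h i))).re with hc
  set d : ι → ℝ := fun i => ‖sqrtOp σ (h i) - (√(t i) : ℂ) • h i‖ ^ 2 with hd
  have hc0 : ∀ i, 0 ≤ c i := fun i => hσ.negMulLog_isPositive.re_inner_nonneg_right (h i)
  have hd0 : ∀ i, 0 ≤ d i := fun i => by positivity
  have hcd : ∀ i, c i + d i ≤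
      -Real.log (t i) * ‖sqrtOp σ (h i)‖ ^ 2 - ‖sqrtOp σ (h i)‖ ^ 2 + t i := fun i => by
    have := inner_negMulLog_add_le hσ.pos (ht i) (h i)
    rw [norm_basis, one_pow, mul_one, sub_mul, one_mul] at this
    exact this
  have hb := (hσC.sub (hσ.hasSum_norm_sqrtOp_sq h)).add hsum
  rw [sub_add_cancel] at hb
  have hcs : Summable c := hb.summable.of_nonneg_of_le hc0
    fun i => (le_add_of_nonneg_right (hd0 i)).trans (hcd i)
  have hds : Summable d := hb.summable.of_nonneg_of_le hd0
    fun i => (le_add_of_nonneg_left (hc0 i)).trans (hcd i)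
  have hle : ∑' i, c i + ∑' i, d i ≤ C := hasSum_le hcd (hcs.hasSum.add hds.hasSum) hb
  have hSσ : vonNeumannEntropy σ = ENNReal.ofReal (∑' i, c i) := by
    rw [vonNeumannEntropy, posTrace_eq_tsum h hσ.negMulLog_isPositive,
      ENNReal.ofReal_tsum_of_nonneg hc0 hcs]
  have hd1 : 0 ≤ ∑' i, d i := tsum_nonneg hd0
  rw [hST, hSσ]
  refine ⟨ENNReal.ofReal_le_ofReal (by linarith), fun hge => ?_⟩
  rw [ENNReal.ofReal_le_ofReal_iff (tsum_nonneg hc0)] at hge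
  have hzero : HasSum d 0 := by
    have : ∑' i, d i = 0 := le_antisymm (by linarith) hd1
    exact this ▸ hds.hasSum
  have hR : ∀ i, sqrtOp σ (h i) = (√(t i) : ℂ) • h i := fun i => by
    have := congrFun ((hasSum_zero_iff_of_nonneg hd0).1 hzero) i
    simpa [hd, sub_eq_zero] using this
  refine eq_of_eigen hT fun i => ?_
  conv_lhs => rw [← sqrtOp_mul_sqrtOp hσ.pos]
  rw [mul_apply_eq_comp, hR, map_smul, hR, smul_smul, ← Complex.ofReal_mul,
    Real.mul_self_sqrt (ht0 i)]

end Entropy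

section Geometric

theorem hasSum_prod_pi {n : ℕ} {f : Fin n → ℕ → ℝ} {s : Fin n → ℝ} (hf : ∀ k m, 0 ≤ f k m)
    (hs : ∀ k, HasSum (f k) (s k)) :
    HasSum (fun α : Fin n → ℕ => ∏ k, f k (α k)) (∏ k, s k) := by
  induction n with
  | zero => simp
  | succ n ih =>
    have h1 := ih (f := fun k => f k.succ) (s := fun k => s k.succ)
      (fun k m => hf k.succ m) fun k => hs k.succ
    have h3 : Summable fun p : ℕ × (Fin n → ℕ) => f 0 p.1 * ∏ k : Fin n, f k.succ (p.2 k) :=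
      Summable.mul_of_nonneg (f := f 0) (g := fun α : Fin n → ℕ => ∏ k : Fin n, f k.succ (α k))
        (hs 0).summable h1.summable (fun m => hf 0 m)
        fun α => Finset.prod_nonneg fun k _ => hf k.succ (α k)
    have h2 := (hs 0).mul h1 h3
    rw [Fin.prod_univ_succ]
    refine ((Fin.consEquiv fun _ : Fin (n + 1) => ℕ).hasSum_iff).1 (h2.congr_fun ?_)
    rintro ⟨m, α⟩
    simp only [Function.comp_apply, Fin.consEquiv_apply, Fin.prod_univ_succ, Fin.cons_zero,
      Fin.cons_succ]

/-- The eigenvalues of a product of thermal states of harmonic oscillators. -/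
noncomputable def geometricWeight {n : ℕ} (x : Fin n → ℝ) (α : Fin n → ℕ) : ℝ :=
  ∏ k, (1 - x k) * x k ^ α k

variable {n : ℕ} {x : Fin n → ℝ}

theorem geometricWeight_pos (h0 : ∀ k, 0 < x k) (h1 : ∀ k, x k < 1) (α : Fin n → ℕ) :
    0 < geometricWeight x α :=
  Finset.prod_pos fun k _ => mul_pos (sub_pos.2 (h1 k)) (pow_pos (h0 k) _)

theorem hasSum_geometric_weight {y : ℝ} (h0 : 0 < y) (h1 : y < 1) :
    HasSum (fun m : ℕ => (1 - y) * y ^ m) 1 := by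
  have := (hasSum_geometric_of_lt_one h0.le h1).mul_left (1 - y)
  rwa [mul_inv_cancel₀ (sub_pos.2 h1).ne'] at this

theorem hasSum_geometricWeight (h0 : ∀ k, 0 < x k) (h1 : ∀ k, x k < 1) :
    HasSum (geometricWeight x) 1 := by
  have := hasSum_prod_pi (f := fun k m => (1 - x k) * x k ^ m) (s := fun _ => 1)
    (fun k m => mul_nonneg (sub_pos.2 (h1 k)).le (pow_pos (h0 k) _).le)
    fun k => hasSum_geometric_weight (h0 k) (h1 k)
  rwa [Finset.prod_const_one] at this

theorem hasSum_number_geometricWeight (h0 : ∀ k, 0 < x k) (h1 : ∀ k, x k < 1) (k : Fin n) :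
    HasSum (fun α => (2 * α k + 1 : ℝ) * geometricWeight x α) ((1 + x k) / (1 - x k)) := by
  have hk : HasSum (fun m : ℕ => (2 * m + 1 : ℝ) * ((1 - x k) * x k ^ m))
      ((1 + x k) / (1 - x k)) := by
    have e1 : ‖x k‖ < 1 := by rw [Real.norm_of_nonneg (h0 k).le]; exact h1 k
    have := ((hasSum_coe_mul_geometric_of_norm_lt_one e1).mul_left (2 * (1 - x k))).add
      (hasSum_geometric_weight (h0 k) (h1 k))
    have hne : 1 - x k ≠ 0 := (sub_pos.2 (h1 k)).ne'
    convert! this using 1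
    · ext m; ring
    · field_simp; ring
  have := hasSum_prod_pi
    (f := fun j m => (if j = k then (2 * m + 1 : ℝ) else 1) * ((1 - x j) * x j ^ m))
    (s := fun j => if j = k then (1 + x k) / (1 - x k) else 1)
    (fun j m => mul_nonneg (by split_ifs <;> positivity)
      (mul_nonneg (sub_pos.2 (h1 j)).le (pow_pos (h0 j) _).le))
    fun j => by
      by_cases hj : j = k
      · subst hj; simpa using hk
      · simpa [hj] using hasSum_geometric_weight (h0 j) (h1 j)
  rw [Finset.prod_ite_eq' Finset.univ k fun _ => (1 + x k) / (1 - x k),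
    if_pos (Finset.mem_univ k)] at this
  refine this.congr_fun fun α => ?_
  rw [Finset.prod_mul_distrib, Finset.prod_ite_eq' Finset.univ k fun j => (2 * α j + 1 : ℝ),
    if_pos (Finset.mem_univ k), geometricWeight]

theorem neg_log_geometricWeight (h0 : ∀ k, 0 < x k) (h1 : ∀ k, x k < 1) (α : Fin n → ℕ) :
    -Real.log (geometricWeight x α) = ∑ k, ((Real.log (x k) / 2 - Real.log (1 - x k))
      + -Real.log (x k) / 2 * (2 * α k + 1)) := by
  rw [geometricWeight, Real.log_prod fun k _ =>
    (mul_pos (sub_pos.2 (h1 k)) (pow_pos (h0 k) _)).ne', ← Finset.sum_neg_distrib]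
  refine Finset.sum_congr rfl fun k _ => ?_
  rw [Real.log_mul (sub_pos.2 (h1 k)).ne' (pow_pos (h0 k) _).ne', Real.log_pow]
  ring

/-- The average of `-ln T` depends only on the normalization and the averages of the number
operators. -/
theorem hasSum_neg_log_geometricWeight_mul (h0 : ∀ k, 0 < x k) (h1 : ∀ k, x k < 1)
    {s : (Fin n → ℕ) → ℝ} (hs : HasSum s 1) {ν : Fin n → ℝ}
    (hν : ∀ k, HasSum (fun α => (2 * α k + 1 : ℝ) * s α) (ν k)) :
    HasSum (fun α => -Real.log (geometricWeight x α) * s α)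
      (∑ k, ((Real.log (x k) / 2 - Real.log (1 - x k)) * 1 + -Real.log (x k) / 2 * ν k)) := by
  refine (hasSum_sum fun k _ => (hs.mul_left (Real.log (x k) / 2 - Real.log (1 - x k))).add
    ((hν k).mul_left (-Real.log (x k) / 2))).congr_fun fun α => ?_
  rw [neg_log_geometricWeight h0 h1, Finset.sum_mul]
  exact Finset.sum_congr rfl fun k _ => by ring

end Geometric

section Products

variable {H : Type*} [NormedAddCommGroup H] [InnerProductSpace ℂ H]

theorem prod_ofFn_apply_of_eigen {n : ℕ} {L : Fin n → H →L[ℂ] H} {c : Fin n → ℂ} {x : H}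
    (hL : ∀ k, L k x = c k • x) : (List.ofFn L).prod x = (∏ k, c k) • x := by
  induction n with
  | zero => simp
  | succ n ih =>
    rw [List.ofFn_succ, List.prod_cons, mul_apply_eq_comp, ih fun k => hL k.succ, map_smul, hL,
      smul_smul, Fin.prod_univ_succ, mul_comm]

end Products

section Packets

variable {n : ℕ} {ħ : ℝ}

/-- The ladder coefficient of `q - Q`. -/
noncomputable def coordCoeff (ħ ΔQ ΔP : ℝ) : ℂ := (√(ħ * ΔQ / (2 * ΔP)) : ℝ)

/-- The ladder coefficient of `p - P`. -/
noncomputable def momCoeff (ħ ΔQ ΔP : ℝ) : ℂ := (√(ħ * ΔP / (2 * ΔQ)) : ℝ) * Complex.I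

theorem coordCoeff_sq {ΔQ ΔP : ℝ} (hħ : 0 < ħ) (hQ : 0 < ΔQ) (hP : 0 < ΔP) :
    coordCoeff ħ ΔQ ΔP ^ 2 = (ħ * ΔQ / (2 * ΔP) : ℝ) := by
  rw [coordCoeff, ← Complex.ofReal_pow, Real.sq_sqrt (by positivity)]

theorem momCoeff_sq {ΔQ ΔP : ℝ} (hħ : 0 < ħ) (hQ : 0 < ΔQ) (hP : 0 < ΔP) :
    momCoeff ħ ΔQ ΔP ^ 2 = -(ħ * ΔP / (2 * ΔQ) : ℝ) := by
  rw [momCoeff, mul_pow, Complex.I_sq, ← Complex.ofReal_pow, Real.sq_sqrt (by positivity),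
    mul_neg_one]

theorem norm_coordCoeff_sq {ΔQ ΔP : ℝ} (hħ : 0 < ħ) (hQ : 0 < ΔQ) (hP : 0 < ΔP) :
    ‖coordCoeff ħ ΔQ ΔP‖ ^ 2 = ħ * ΔQ / (2 * ΔP) := by
  rw [← norm_pow, coordCoeff_sq hħ hQ hP, Complex.norm_real, Real.norm_of_nonneg (by positivity)]

theorem norm_momCoeff_sq {ΔQ ΔP : ℝ} (hħ : 0 < ħ) (hQ : 0 < ΔQ) (hP : 0 < ΔP) :
    ‖momCoeff ħ ΔQ ΔP‖ ^ 2 = ħ * ΔP / (2 * ΔQ) := by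
  rw [← norm_pow, momCoeff_sq hħ hQ hP, norm_neg, Complex.norm_real,
    Real.norm_of_nonneg (by positivity)]

theorem coordCoeff_momCoeff_cancel {ΔQ ΔP : ℝ} (hħ : 0 < ħ) (hQ : 0 < ΔQ) (hP : 0 < ΔP) :
    ((1 / 2 * (ΔP / ΔQ) : ℝ) : ℂ) * coordCoeff ħ ΔQ ΔP ^ 2 +
      ((1 / 2 * (ΔQ / ΔP) : ℝ) : ℂ) * momCoeff ħ ΔQ ΔP ^ 2 = 0 := by
  rw [coordCoeff_sq hħ hQ hP, momCoeff_sq hħ hQ hP, ← Complex.ofReal_neg, ← Complex.ofReal_mul,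
    ← Complex.ofReal_mul, ← Complex.ofReal_add, Complex.ofReal_eq_zero]
  field_simp
  ring

theorem coordCoeff_momCoeff_energy {ΔQ ΔP : ℝ} (hħ : 0 < ħ) (hQ : 0 < ΔQ) (hP : 0 < ΔP) :
    (1 / 2 * (ΔP / ΔQ)) * ‖coordCoeff ħ ΔQ ΔP‖ ^ 2 +
      (1 / 2 * (ΔQ / ΔP)) * ‖momCoeff ħ ΔQ ΔP‖ ^ 2 = ħ / 2 := by
  rw [norm_coordCoeff_sq hħ hQ hP, norm_momCoeff_sq hħ hQ hP]
  field_simp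
  ring

/-- The Boltzmann factor `(ν - 1) / (ν + 1)`. -/
noncomputable def boltzmann (ν : ℝ) : ℝ := (ν - 1) / (ν + 1)

theorem boltzmann_pos {ν : ℝ} (h : 1 < ν) : 0 < boltzmann ν :=
  div_pos (by linarith) (by linarith)

theorem boltzmann_lt_one {ν : ℝ} (h : 1 < ν) : boltzmann ν < 1 := by
  rw [boltzmann, div_lt_one (by linarith)]
  linarith

theorem boltzmann_inverse {ν : ℝ} (h : 1 < ν) : (1 + boltzmann ν) / (1 - boltzmann ν) = ν := by
  have h1 : ν + 1 ≠ 0 := by linarith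
  have h2 : 1 - boltzmann ν ≠ 0 := (sub_pos.2 (boltzmann_lt_one h)).ne'
  rw [div_eq_iff h2, boltzmann]
  field_simp
  ring

theorem normalized_exp_eq {ν : ℝ} (h : 1 < ν) (hħ : 0 < ħ) (m : ℕ) :
    2 / √(ν ^ 2 - 1) * Real.exp (-(1 / ħ) * Real.log ((ν + 1) / (ν - 1)) * (ħ / 2 * (2 * m + 1))) =
      (1 - boltzmann ν) * boltzmann ν ^ m := by
  have hx := boltzmann_pos h
  have e1 : -(1 / ħ) * Real.log ((ν + 1) / (ν - 1)) * (ħ / 2 * (2 * m + 1)) =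
      Real.log (boltzmann ν) * m + Real.log (boltzmann ν) / 2 := by
    rw [show (ν + 1) / (ν - 1) = (boltzmann ν)⁻¹ by rw [boltzmann, inv_div], Real.log_inv]
    field_simp
  have e2 : Real.exp (Real.log (boltzmann ν) / 2) = √(ν - 1) / √(ν + 1) := by
    rw [← Real.log_sqrt hx.le, Real.exp_log (Real.sqrt_pos.2 hx), boltzmann,
      Real.sqrt_div (by linarith)]
  have e3 : √(ν ^ 2 - 1) = √(ν - 1) * √(ν + 1) := by
    rw [← Real.sqrt_mul (by linarith)]
    congr 1
    ring
  have h1 : √(ν - 1) ≠ 0 := (Real.sqrt_pos.2 (by linarith)).ne'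
  have h2 : √(ν + 1) ≠ 0 := (Real.sqrt_pos.2 (by linarith)).ne'
  have h3 : √(ν + 1) ^ 2 = ν + 1 := Real.sq_sqrt (by linarith)
  have h4 : 1 - boltzmann ν = 2 / (ν + 1) := by
    have h1 : ν + 1 ≠ 0 := by linarith
    rw [boltzmann]
    field_simp
    ring
  rw [e1, Real.exp_add, mul_comm (Real.log _), Real.exp_nat_mul, Real.exp_log hx, e2, e3, h4, div_mul_eq_mul_div,
    div_mul_eq_mul_div, div_eq_div_iff (mul_ne_zero h1 h2) (by linarith), ← h3]
  rw [h3]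
  field_simp
  rw [h3]

variable {Q P ΔQ ΔP : Fin n → ℝ} {h : HilbertBasis (Fin n → ℕ) ℂ (Wave n)}

theorem opExp_opK_apply (hħ : 0 < ħ) {k : Fin n} {Q P ΔQ ΔP c : ℝ} (hQ : 0 < ΔQ) (hP : 0 < ΔP)
    (hX : IsLadder h k (subConst (position k) Q) (coordCoeff ħ ΔQ ΔP))
    (hY : IsLadder h k (subConst (momentum ħ k) P) (momCoeff ħ ΔQ ΔP)) (hc : c < 0)
    (α : Fin n → ℕ) :
    opExp ((c : ℂ) • opK ħ k Q P ΔQ ΔP) (h α) =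
      (Real.exp (c * (ħ / 2 * (2 * α k + 1))) : ℂ) • h α := by
  have hc0 : (c : ℂ) ≠ 0 := by exact_mod_cast hc.ne
  refine opExp_apply_of_diagonal h (d := fun α => c * (ħ / 2 * (2 * α k + 1)))
    (fun α => mul_nonpos_of_nonpos_of_nonneg hc.le (by positivity)) (fun x y => ?_) α
  have hK : ∀ y, (x, y) ∈ (opK ħ k Q P ΔQ ΔP).graph ↔
      ∀ α, inner ℂ (h α) y = (ħ / 2 * (2 * α k + 1) : ℝ) * inner ℂ (h α) x := fun y =>
    hX.mem_graph_energy hY (half_pos hħ) (coordCoeff_momCoeff_cancel hħ hQ hP)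
      (coordCoeff_momCoeff_energy hħ hQ hP) x y
  rw [mem_graph_smul]
  constructor
  · rintro ⟨y, hy, rfl⟩ α
    rw [inner_smul_right, (hK y).1 hy, Complex.ofReal_mul c, mul_assoc]
  · intro hy
    refine ⟨(c : ℂ)⁻¹ • y, (hK _).2 fun α => ?_, by rw [smul_smul, mul_inv_cancel₀ hc0, one_smul]⟩
    rw [inner_smul_right, hy α, Complex.ofReal_mul c, mul_assoc, inv_mul_cancel_left₀ hc0]

theorem packetT_apply (hħ : 0 < ħ) (hΔQ : ∀ k, 0 < ΔQ k) (hΔP : ∀ k, 0 < ΔP k)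
    (hν : ∀ k, 1 < nu ħ (ΔQ k) (ΔP k))
    (hX : ∀ k, IsLadder h k (subConst (position k) (Q k)) (coordCoeff ħ (ΔQ k) (ΔP k)))
    (hY : ∀ k, IsLadder h k (subConst (momentum ħ k) (P k)) (momCoeff ħ (ΔQ k) (ΔP k)))
    (α : Fin n → ℕ) :
    packetT ħ Q P ΔQ ΔP (h α) =
      (geometricWeight (fun k => boltzmann (nu ħ (ΔQ k) (ΔP k))) α : ℂ) • h α := by
  rw [packetT, prod_ofFn_apply_of_eigen (c := fun k =>
    (((1 - boltzmann (nu ħ (ΔQ k) (ΔP k))) * boltzmann (nu ħ (ΔQ k) (ΔP k)) ^ α k : ℝ) : ℂ)),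
    geometricWeight, Complex.ofReal_prod]
  intro k
  have hlog : 0 < Real.log ((nu ħ (ΔQ k) (ΔP k) + 1) / (nu ħ (ΔQ k) (ΔP k) - 1)) := by
    refine Real.log_pos ?_
    rw [lt_div_iff₀ (by linarith [hν k])]
    linarith
  rw [smul_apply, opExp_opK_apply hħ (hΔQ k) (hΔP k) (hX k) (hY k)
    (mul_neg_of_neg_of_pos (neg_neg_of_pos (by positivity)) hlog), smul_smul, ← Complex.ofReal_mul,
    normalized_exp_eq (hν k) hħ]

/-- The characterization of maximum entropy packets, given the basis of Hermite functions. -/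
theorem isMaxEntropyPacket_iff_of_isLadder (hħ : 0 < ħ) (hΔQ : ∀ k, 0 < ΔQ k)
    (hΔP : ∀ k, 0 < ΔP k) (hν : ∀ k, 1 < nu ħ (ΔQ k) (ΔP k))
    (hX : ∀ k, IsLadder h k (subConst (position k) (Q k)) (coordCoeff ħ (ΔQ k) (ΔP k)))
    (hY : ∀ k, IsLadder h k (subConst (momentum ħ k) (P k)) (momCoeff ħ (ΔQ k) (ΔP k)))
    (ρ : Wave n →L[ℂ] Wave n) :
    IsMaxEntropyPacket ħ Q P ΔQ ΔP ρ ↔ ρ = packetT ħ Q P ΔQ ΔP := by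
  set x : Fin n → ℝ := fun k => boltzmann (nu ħ (ΔQ k) (ΔP k)) with hx
  have h0 : ∀ k, 0 < x k := fun k => boltzmann_pos (hν k)
  have h1 : ∀ k, x k < 1 := fun k => boltzmann_lt_one (hν k)
  have hT : ∀ α, packetT ħ Q P ΔQ ΔP (h α) = (geometricWeight x α : ℂ) • h α :=
    packetT_apply hħ hΔQ hΔP hν hX hY
  have ht : ∀ α, 0 < geometricWeight x α := geometricWeight_pos h0 h1
  have hsum := hasSum_geometricWeight h0 h1
  have hnum : ∀ k, HasSum (fun α => (2 * α k + 1 : ℝ) * geometricWeight x α)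
      (nu ħ (ΔQ k) (ΔP k)) := fun k => by
    have := hasSum_number_geometricWeight h0 h1 k
    rwa [hx, boltzmann_inverse (hν k)] at this
  have hcon : HasAveragesAndVariances ħ Q P ΔQ ΔP (packetT ħ Q P ΔQ ΔP) := by
    refine ⟨isState_of_eigen hT (fun α => (ht α).le) hsum, fun k => ?_, fun k => ?_⟩
    · have hQ := hΔQ k
      have hP := hΔP k
      have hn := norm_coordCoeff_sq hħ hQ hP
      refine (hX k).hasMeanStd_of_eigen hT (fun α => (ht α).le) hsum ?_ fun e => ?_
      · convert! (hnum k).mul_left (‖coordCoeff ħ (ΔQ k) (ΔP k)‖ ^ 2) using 1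
        rw [hn, nu]
        field_simp
      · rw [e, norm_zero, zero_pow two_ne_zero] at hn
        exact absurd hn (by positivity)
    · have hQ := hΔQ k
      have hP := hΔP k
      have hn := norm_momCoeff_sq hħ hQ hP
      refine (hY k).hasMeanStd_of_eigen hT (fun α => (ht α).le) hsum ?_ fun e => ?_
      · convert! (hnum k).mul_left (‖momCoeff ħ (ΔQ k) (ΔP k)‖ ^ 2) using 1
        rw [hn, nu]
        field_simp
      · rw [e, norm_zero, zero_pow two_ne_zero] at hn
        exact absurd hn (by positivity)
  have hent : ∀ σ, HasAveragesAndVariances ħ Q P ΔQ ΔP σ →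
      vonNeumannEntropy σ ≤ vonNeumannEntropy (packetT ħ Q P ΔQ ΔP) ∧
      (vonNeumannEntropy (packetT ħ Q P ΔQ ΔP) ≤ vonNeumannEntropy σ →
        σ = packetT ħ Q P ΔQ ΔP) := by
    intro σ hσ
    refine hσ.state.entropy_le_and_eq hT ht hsum
      (hasSum_neg_log_geometricWeight_mul h0 h1 hsum hnum)
      (hasSum_neg_log_geometricWeight_mul h0 h1 (hσ.state.hasSum_norm_sqrtOp_sq h) fun k => ?_)
    have hQ := hΔQ k
    have hP := hΔP k
    have := hasSum_number_of_hasMeanStd (hX k) (hY k) (half_pos hħ)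
      (coordCoeff_momCoeff_cancel hħ hQ hP) (coordCoeff_momCoeff_energy hħ hQ hP)
      (hσ.coord k) (hσ.mom k)
    convert! this using 1
    rw [nu]
    field_simp
    ring
  constructor
  · intro hρ
    exact (hent ρ hρ.constraints).2 (hρ.maximal _ hcon)
  · rintro rfl
    exact ⟨hcon, fun σ hσ => (hent σ hσ).1⟩

end Packets

section Canonical

open FourierTransform LineDeriv

variable {n : ℕ} {k : Fin n} {ħ : ℝ}

theorem mem_graph_position {ψ φ : Wave n} :
    (ψ, φ) ∈ (position k).graph ↔ φ =ᵐ[volume] fun x => ((x k : ℝ) : ℂ) * ψ x := by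
  rw [LinearPMap.mem_graph_iff]
  constructor
  · rintro ⟨u, rfl, rfl⟩
    exact MemLp.coeFn_toLp ((mem_positionDomain k u).1 u.2)
  · intro h
    have hm : ψ ∈ positionDomain k := (mem_positionDomain k ψ).2 ((Lp.memLp φ).ae_eq h)
    refine ⟨⟨ψ, hm⟩, rfl, Lp.ext ?_⟩
    exact (MemLp.coeFn_toLp ((mem_positionDomain k ψ).1 hm)).trans h.symm

theorem mem_graph_momentum (hħ : ħ ≠ 0) {ψ φ : Wave n} :
    (ψ, φ) ∈ (momentum ħ k).graph ↔
      (fourierL2 n ψ, (((2 * Real.pi * ħ : ℝ) : ℂ)⁻¹) • fourierL2 n φ) ∈ (position k).graph := by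
  have hc : ((2 * Real.pi * ħ : ℝ) : ℂ) ≠ 0 := by
    exact_mod_cast mul_ne_zero (by positivity) hħ
  simp only [LinearPMap.mem_graph_iff]
  constructor
  · rintro ⟨u, rfl, rfl⟩
    refine ⟨⟨fourierL2 n u, u.2⟩, rfl, ?_⟩
    change _ = (((2 * Real.pi * ħ : ℝ) : ℂ)⁻¹) • fourierL2 n (((2 * Real.pi * ħ : ℝ) : ℂ) •
      (fourierL2 n).symm (position k ⟨fourierL2 n u, u.2⟩))
    rw [map_smul, smul_smul, inv_mul_cancel₀ hc, one_smul, LinearIsometryEquiv.apply_symm_apply]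
  · rintro ⟨u, hu, hv⟩
    have hm : ψ ∈ (momentum ħ k).domain := by
      change fourierL2 n ψ ∈ (position k).domain
      exact hu ▸ u.2
    refine ⟨⟨ψ, hm⟩, rfl, ?_⟩
    change ((2 * Real.pi * ħ : ℝ) : ℂ) • (fourierL2 n).symm (position k ⟨fourierL2 n ψ, hm⟩) = _
    rw [show (⟨fourierL2 n ψ, hm⟩ : (position k).domain) = u from Subtype.ext hu.symm, hv,
      map_smul, smul_smul, mul_inv_cancel₀ hc, one_smul, LinearIsometryEquiv.symm_apply_apply]

theorem isClosed_position (k : Fin n) : (position k).IsClosed := by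
  refine IsSeqClosed.isClosed fun u p hu hup => ?_
  have h1 : Tendsto (fun i => (u i).1) atTop (𝓝 p.1) := (continuous_fst.tendsto p).comp hup
  have h2 : Tendsto (fun i => (u i).2) atTop (𝓝 p.2) := (continuous_snd.tendsto p).comp hup
  obtain ⟨ns, hns, h3⟩ := (tendstoInMeasure_of_tendsto_Lp h1).exists_seq_tendsto_ae
  obtain ⟨ms, hms, h4⟩ :=
    (tendstoInMeasure_of_tendsto_Lp (h2.comp hns.tendsto_atTop)).exists_seq_tendsto_ae
  refine mem_graph_position.2 ?_
  have h5 : ∀ᵐ x : EuclideanSpace ℝ (Fin n), ∀ i, (u i).2 x = ((x k : ℝ) : ℂ) * (u i).1 x :=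
    ae_all_iff.2 fun i => mem_graph_position.1 (hu i)
  filter_upwards [h3, h4, h5] with x hx3 hx4 hx5
  refine tendsto_nhds_unique hx4 ?_
  refine (((hx3.comp hms.tendsto_atTop).const_mul ((x k : ℝ) : ℂ))).congr fun i => ?_
  exact (hx5 _).symm

theorem position_symm {x x' y y' : Wave n} (hx : (x, x') ∈ (position k).graph)
    (hy : (y, y') ∈ (position k).graph) : inner ℂ x' y = inner ℂ x y' := by
  rw [L2.inner_def, L2.inner_def]
  refine integral_congr_ae ?_
  filter_upwards [mem_graph_position.1 hx, mem_graph_position.1 hy] with t h1 h2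
  rw [h1, h2]
  simp only [RCLike.inner_apply, map_mul, Complex.conj_ofReal]
  ring

theorem isClosed_momentum (hħ : ħ ≠ 0) (k : Fin n) : (momentum ħ k).IsClosed := by
  have e : ((momentum ħ k).graph : Set (Wave n × Wave n)) =
      (fun p : Wave n × Wave n => (fourierL2 n p.1,
        (((2 * Real.pi * ħ : ℝ) : ℂ)⁻¹) • fourierL2 n p.2)) ⁻¹' ((position k).graph : Set _) := by
    ext p
    exact mem_graph_momentum hħ
  rw [LinearPMap.IsClosed, e]
  exact (isClosed_position k).preimage (by fun_prop)

theorem momentum_symm (hħ : ħ ≠ 0) {x x' y y' : Wave n} (hx : (x, x') ∈ (momentum ħ k).graph)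
    (hy : (y, y') ∈ (momentum ħ k).graph) : inner ℂ x' y = inner ℂ x y' := by
  have hc : ((2 * Real.pi * ħ : ℝ) : ℂ)⁻¹ ≠ 0 := inv_ne_zero <| by
    exact_mod_cast mul_ne_zero (by positivity) hħ
  have := position_symm ((mem_graph_momentum hħ).1 hx) ((mem_graph_momentum hħ).1 hy)
  rw [inner_smul_left, inner_smul_right, LinearIsometryEquiv.inner_map_map,
    LinearIsometryEquiv.inner_map_map, map_inv₀, Complex.conj_ofReal] at this
  exact mul_left_cancel₀ hc this

theorem isClosed_subConst {H : Type*} [NormedAddCommGroup H] [InnerProductSpace ℂ H]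
    {A : H →ₗ.[ℂ] H} (hA : A.IsClosed) (a : ℝ) : (subConst A a).IsClosed := by
  have e : ((subConst A a).graph : Set (H × H)) =
      (fun p : H × H => (p.1, p.2 + (a : ℂ) • p.1)) ⁻¹' (A.graph : Set _) := by
    ext p
    exact mem_graph_subConst
  rw [LinearPMap.IsClosed, e]
  exact hA.preimage (by fun_prop)

theorem subConst_symm {H : Type*} [NormedAddCommGroup H] [InnerProductSpace ℂ H]
    {A : H →ₗ.[ℂ] H}
    (hA : ∀ {x x' y y' : H}, (x, x') ∈ A.graph → (y, y') ∈ A.graph → inner ℂ x' y = inner ℂ x y')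
    {a : ℝ} {x x' y y' : H} (hx : (x, x') ∈ (subConst A a).graph)
    (hy : (y, y') ∈ (subConst A a).graph) : inner ℂ x' y = inner ℂ x y' := by
  have := hA (mem_graph_subConst.1 hx) (mem_graph_subConst.1 hy)
  rw [inner_add_left, inner_add_right, inner_smul_left, inner_smul_right,
    Complex.conj_ofReal] at this
  exact add_right_cancel this

/-- Schwartz functions on `ℝⁿ`. -/
abbrev Schwartz (n : ℕ) : Type := SchwartzMap (EuclideanSpace ℝ (Fin n)) ℂ

theorem hasTemperateGrowth_coord (k : Fin n) :
    (fun x : EuclideanSpace ℝ (Fin n) => ((x k : ℝ) : ℂ)).HasTemperateGrowth :=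
  (Complex.ofRealCLM.comp (EuclideanSpace.proj k)).hasTemperateGrowth

/-- Multiplication of Schwartz functions by the `k`-th coordinate. -/
noncomputable def mulCoord (k : Fin n) : Schwartz n →ₗ[ℂ] Schwartz n :=
  (SchwartzMap.smulLeftCLM ℂ fun x : EuclideanSpace ℝ (Fin n) => ((x k : ℝ) : ℂ)).toLinearMap

/-- The `k`-th partial derivative of Schwartz functions. -/
noncomputable def derivCoord (k : Fin n) : Schwartz n →ₗ[ℂ] Schwartz n :=
  (lineDerivOpCLM ℂ (Schwartz n) (EuclideanSpace.single k (1 : ℝ))).toLinearMap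

theorem mulCoord_apply (k : Fin n) (f : Schwartz n) (x : EuclideanSpace ℝ (Fin n)) :
    mulCoord k f x = ((x k : ℝ) : ℂ) * f x :=
  SchwartzMap.smulLeftCLM_apply_apply (hasTemperateGrowth_coord k) f x

theorem derivCoord_apply (k : Fin n) (f : Schwartz n) (x : EuclideanSpace ℝ (Fin n)) :
    derivCoord k f x = fderiv ℝ f x (EuclideanSpace.single k 1) := rfl

/-- The inclusion of the Schwartz functions into `L²`. -/
noncomputable def toWave : Schwartz n →ₗ[ℂ] Wave n :=
  (SchwartzMap.toLpCLM ℂ ℂ 2 (volume : Measure (EuclideanSpace ℝ (Fin n)))).toLinearMap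

theorem coeFn_toWave (f : Schwartz n) : (toWave f : EuclideanSpace ℝ (Fin n) → ℂ) =ᵐ[volume] f :=
  SchwartzMap.coeFn_toLp f 2

theorem toWave_mem_graph_position (k : Fin n) (f : Schwartz n) :
    (toWave f, toWave (mulCoord k f)) ∈ (position k).graph := by
  refine mem_graph_position.2 ?_
  filter_upwards [coeFn_toWave f, coeFn_toWave (mulCoord k f)] with x h1 h2
  rw [h1, h2, mulCoord_apply]

theorem fourierL2_toWave (f : Schwartz n) : fourierL2 n (toWave f) = toWave (𝓕 f) :=
  SchwartzMap.toLp_fourier_eq f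

theorem fourier_derivCoord (k : Fin n) (f : Schwartz n) :
    𝓕 (derivCoord k f) = (2 * Real.pi * Complex.I) • mulCoord k (𝓕 f) := by
  refine (SchwartzMap.fourier_lineDerivOp_eq f (EuclideanSpace.single k (1 : ℝ))).trans ?_
  congr 1
  ext x
  have h : (fun x : EuclideanSpace ℝ (Fin n) =>
      inner ℝ x (EuclideanSpace.single k (1 : ℝ))).HasTemperateGrowth :=
    Function.hasTemperateGrowth_inner_left _
  have e : inner ℝ x (EuclideanSpace.single k (1 : ℝ)) = x k := by
    simp [EuclideanSpace.inner_single_right]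
  rw [SchwartzMap.smulLeftCLM_apply_apply h, mulCoord_apply, e]
  rfl

theorem toWave_mem_graph_momentum (hħ : ħ ≠ 0) (k : Fin n) (f : Schwartz n) :
    (toWave f, toWave ((-(Complex.I * ħ)) • derivCoord k f)) ∈ (momentum ħ k).graph := by
  have hpi : (Real.pi : ℂ) ≠ 0 := by exact_mod_cast Real.pi_ne_zero
  have hħ' : (ħ : ℂ) ≠ 0 := by exact_mod_cast hħ
  rw [mem_graph_momentum hħ]
  convert! toWave_mem_graph_position k (𝓕 f) using 2
  · exact fourierL2_toWave f
  · rw [map_smul, map_smul, fourierL2_toWave, fourier_derivCoord, map_smul, smul_smul, smul_smul]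
    convert! one_smul ℂ _ using 2
    push_cast
    field_simp
    simp

end Canonical

section Gaussian

theorem norm_iteratedFDeriv_cexp_le (m : ℕ) (z : ℂ) :
    ‖iteratedFDeriv ℝ m Complex.exp z‖ ≤ Real.exp z.re := by
  induction m with
  | zero => rw [norm_iteratedFDeriv_zero, Complex.norm_exp]
  | succ m ih =>
    have e : fderiv ℝ Complex.exp =
        (ContinuousLinearMap.mul ℝ ℂ : ℂ →L[ℝ] ℂ →L[ℝ] ℂ) ∘ Complex.exp := by
      funext w
      refine HasFDerivAt.fderiv ?_
      convert! (Complex.hasDerivAt_exp w).hasFDerivAt.restrictScalars ℝ using 1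
      ext u
      simp [mul_comm]
    rw [← norm_iteratedFDeriv_fderiv, e]
    refine (ContinuousLinearMap.norm_iteratedFDeriv_comp_left _
      (Complex.contDiff_exp (𝕜 := ℝ) (n := m)).contDiffAt le_rfl).trans ?_
    calc _ ≤ 1 * Real.exp z.re := by
          gcongr
          exact ContinuousLinearMap.opNorm_mul_le ℝ ℂ
      _ = _ := one_mul _

/-- The exponential of a function of temperate growth with linearly decaying real part. -/
noncomputable def schwartzExp {E : Type*} [NormedAddCommGroup E] [NormedSpace ℝ E] (f : E → ℂ)
    (hf : f.HasTemperateGrowth) (hd : ∃ C : ℝ, ∀ x, (f x).re ≤ C - ‖x‖) : SchwartzMap E ℂ where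
  toFun x := Complex.exp (f x)
  smooth' := Complex.contDiff_exp.comp hf.1
  decay' := by
    intro k m
    obtain ⟨C, hC⟩ := hd
    obtain ⟨j, A, hA, h⟩ := hf.norm_iteratedFDeriv_le_uniform m
    refine ⟨m.factorial * Real.exp C * (1 + A) ^ m * ((k + j * m).factorial * Real.exp 1),
      fun x => ?_⟩
    have h1 : ‖iteratedFDeriv ℝ m (fun x => Complex.exp (f x)) x‖ ≤
        m.factorial * Real.exp (f x).re * ((1 + A) * (1 + ‖x‖) ^ j) ^ m := by
      refine norm_iteratedFDeriv_comp_le (Complex.contDiff_exp (𝕜 := ℝ) (n := m))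
        (hf.1.of_le (by exact_mod_cast le_top)) le_rfl x
        (fun i _ => norm_iteratedFDeriv_cexp_le i (f x)) (fun i hi him => ?_)
      have h2 : (1 : ℝ) ≤ (1 + A) * (1 + ‖x‖) ^ j :=
        one_le_mul_of_one_le_of_one_le (by linarith)
          (one_le_pow₀ (by linarith [norm_nonneg x]))
      refine (h i him x).trans (le_trans ?_ (le_self_pow₀ h2 (by omega)))
      gcongr
      linarith
    have h3 : Real.exp (f x).re ≤ Real.exp C * Real.exp (-‖x‖) := by
      rw [← Real.exp_add]
      exact Real.exp_le_exp.2 (by linarith [hC x])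
    have h4 : (1 + ‖x‖) ^ (k + j * m) * Real.exp (-‖x‖) ≤
        (k + j * m).factorial * Real.exp 1 := by
      have := Real.pow_div_factorial_le_exp (1 + ‖x‖) (by positivity) (k + j * m)
      rw [div_le_iff₀ (by positivity)] at this
      calc _ ≤ (Real.exp (1 + ‖x‖) * (k + j * m).factorial) * Real.exp (-‖x‖) := by gcongr
        _ = (k + j * m).factorial * (Real.exp (1 + ‖x‖) * Real.exp (-‖x‖)) := by ring
        _ = _ := by rw [← Real.exp_add]; ring_nf
    calc ‖x‖ ^ k * ‖iteratedFDeriv ℝ m (fun x => Complex.exp (f x)) x‖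
        ≤ (1 + ‖x‖) ^ k * (m.factorial * (Real.exp C * Real.exp (-‖x‖)) *
            ((1 + A) * (1 + ‖x‖) ^ j) ^ m) := by
          gcongr
          · linarith
          · exact h1.trans (by gcongr)
      _ = m.factorial * Real.exp C * (1 + A) ^ m *
            ((1 + ‖x‖) ^ (k + j * m) * Real.exp (-‖x‖)) := by
          rw [mul_pow, ← pow_mul, pow_add]; ring
      _ ≤ _ := by gcongr

variable {n : ℕ}

/-- The exponent of a Gaussian wave packet with centre `Q`, wave vector `p` and width
parameters `s`. -/
noncomputable def packetExponent (s Q p : Fin n → ℝ) (x : EuclideanSpace ℝ (Fin n)) : ℂ :=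
  ∑ k, (-(s k : ℂ) * (((x k : ℝ) : ℂ) - Q k) ^ 2 + Complex.I * p k * ((x k : ℝ) : ℂ))

theorem hasTemperateGrowth_packetExponent (s Q p : Fin n → ℝ) :
    (packetExponent s Q p).HasTemperateGrowth := by
  refine Function.HasTemperateGrowth.sum fun k _ => ?_
  have hx := hasTemperateGrowth_coord k
  exact ((Function.HasTemperateGrowth.const _).mul
    ((hx.sub (Function.HasTemperateGrowth.const _)).pow 2)).add
    ((Function.HasTemperateGrowth.const _).mul hx)

theorem re_packetExponent (s Q p : Fin n → ℝ) (x : EuclideanSpace ℝ (Fin n)) :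
    (packetExponent s Q p x).re = ∑ k, -(s k * (x k - Q k) ^ 2) := by
  rw [packetExponent, Complex.re_sum]
  refine Finset.sum_congr rfl fun k _ => ?_
  rw [show -(s k : ℂ) * (((x k : ℝ) : ℂ) - Q k) ^ 2 + Complex.I * p k * ((x k : ℝ) : ℂ) =
    ((-(s k * (x k - Q k) ^ 2) : ℝ) : ℂ) + ((p k * x k : ℝ) : ℂ) * Complex.I by push_cast; ring]
  simp only [Complex.add_re, Complex.ofReal_re, Complex.re_ofReal_mul, Complex.I_re, mul_zero,
    add_zero]

theorem exists_re_packetExponent_le {s : Fin n → ℝ} (hs : ∀ k, 0 < s k) (Q p : Fin n → ℝ)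
    {R : ℝ} (hR : 0 ≤ R) : ∃ C : ℝ, ∀ x, (packetExponent s Q p x).re ≤ C - R * ‖x‖ := by
  refine ⟨∑ k, (R * |Q k| + R ^ 2 / (4 * s k)), fun x => ?_⟩
  have h1 : ‖x‖ ≤ ∑ k, |x k| := by
    conv_lhs => rw [← (EuclideanSpace.basisFun (Fin n) ℝ).sum_repr x]
    refine (norm_sum_le _ _).trans (Finset.sum_le_sum fun k _ => ?_)
    rw [norm_smul]
    simp
  have h2 : R * ‖x‖ ≤ ∑ k, R * |x k| := by
    rw [← Finset.mul_sum]
    gcongr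
  have h3 : ∑ k, -(s k * (x k - Q k) ^ 2) + ∑ k, R * |x k| ≤
      ∑ k, (R * |Q k| + R ^ 2 / (4 * s k)) := by
    rw [← Finset.sum_add_distrib]
    refine Finset.sum_le_sum fun k _ => ?_
    have h4 : |x k| ≤ |Q k| + |x k - Q k| := by
      calc |x k| = |Q k + (x k - Q k)| := by ring_nf
        _ ≤ _ := abs_add_le _ _
    have h5 : R * |x k - Q k| ≤ s k * (x k - Q k) ^ 2 + R ^ 2 / (4 * s k) := by
      have h6 : 0 ≤ (2 * s k * |x k - Q k| - R) ^ 2 / (4 * s k) :=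
        div_nonneg (sq_nonneg _) (by linarith [hs k])
      have h7 : (2 * s k * |x k - Q k| - R) ^ 2 / (4 * s k) =
          s k * |x k - Q k| ^ 2 - R * |x k - Q k| + R ^ 2 / (4 * s k) := by
        have := (hs k).ne'
        field_simp
        ring
      rw [sq_abs] at h7
      linarith
    have := mul_le_mul_of_nonneg_left h4 hR
    linarith
  rw [re_packetExponent]
  linarith

/-- The Gaussian wave packet as a Schwartz function. -/
noncomputable def gaussianPacket {s : Fin n → ℝ} (hs : ∀ k, 0 < s k) (Q p : Fin n → ℝ) :
    Schwartz n :=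
  schwartzExp (packetExponent s Q p) (hasTemperateGrowth_packetExponent s Q p) <| by
    simpa using exists_re_packetExponent_le hs Q p zero_le_one

theorem gaussianPacket_apply {s : Fin n → ℝ} (hs : ∀ k, 0 < s k) (Q p : Fin n → ℝ)
    (x : EuclideanSpace ℝ (Fin n)) :
    gaussianPacket hs Q p x = Complex.exp (packetExponent s Q p x) := rfl

theorem derivCoord_gaussianPacket {s : Fin n → ℝ} (hs : ∀ k, 0 < s k) (Q p : Fin n → ℝ)
    (k : Fin n) (x : EuclideanSpace ℝ (Fin n)) :
    derivCoord k (gaussianPacket hs Q p) x =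
      (-(2 * s k : ℂ) * (((x k : ℝ) : ℂ) - Q k) + Complex.I * p k) *
        gaussianPacket hs Q p x := by
  have hc : ∀ j, HasFDerivAt (fun x : EuclideanSpace ℝ (Fin n) => ((x j : ℝ) : ℂ))
      (Complex.ofRealCLM.comp (EuclideanSpace.proj j : EuclideanSpace ℝ (Fin n) →L[ℝ] ℝ)) x :=
    fun j => (Complex.ofRealCLM.comp (EuclideanSpace.proj j)).hasFDerivAt
  have h1 := (HasFDerivAt.fun_sum (u := Finset.univ) fun j _ =>
    ((((hc j).sub_const (Q j : ℂ)).pow 2).const_mul (-(s j : ℂ))).add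
      ((hc j).const_mul (Complex.I * p j))).cexp
  rw [derivCoord_apply]
  have h2 : (gaussianPacket hs Q p : EuclideanSpace ℝ (Fin n) → ℂ) = fun x =>
      Complex.exp (packetExponent s Q p x) := rfl
  rw [h2]
  refine (congrArg (fun L : EuclideanSpace ℝ (Fin n) →L[ℝ] ℂ =>
    L (EuclideanSpace.single k 1)) (HasFDerivAt.fderiv h1)).trans ?_
  change Complex.exp (packetExponent s Q p x) * ((∑ j, _ : EuclideanSpace ℝ (Fin n) →L[ℝ] ℂ) _) = _
  rw [mul_comm]
  congr 1
  rw [sum_apply, Finset.sum_eq_single k (fun j _ h => by simp [h]) (by simp)]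
  simp
  ring

end Gaussian

section LadderConstruction

variable {n : ℕ}

theorem raise_lower_comm {k j : Fin n} (h : k ≠ j) (α : Fin n → ℕ) :
    raise j (lower k α) = lower k (raise j α) := by
  funext i
  simp only [raise, lower, Pi.add_apply, Pi.sub_apply, Pi.single_apply]
  split_ifs <;> simp_all

theorem multiIndex_induction {p : (Fin n → ℕ) → Prop} (zero : p 0)
    (step : ∀ k α, p α → p (raise k α)) (α : Fin n → ℕ) : p α := by
  induction hN : ∑ i, α i generalizing α with
  | zero =>
    have : α = 0 := funext fun i => by
      simpa using (Finset.sum_eq_zero_iff.1 hN) i (Finset.mem_univ i)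
    exact this ▸ zero
  | succ N ih =>
    obtain ⟨k, -, hk⟩ := Finset.exists_ne_zero_of_sum_ne_zero (hN.trans_ne N.succ_ne_zero)
    rw [← raise_lower hk]
    refine step k _ (ih _ ?_)
    have h1 : ∑ i, raise k (lower k α) i = N + 1 := by rw [raise_lower hk, hN]
    simp only [raise, Pi.add_apply, Finset.sum_add_distrib, Finset.sum_pi_single',
      Finset.mem_univ, if_true] at h1
    exact Nat.succ_injective h1

variable {V : Type*} [AddCommGroup V] [Module ℂ V]

theorem commute_powersHom {c : Fin n → Module.End ℂ V}
    (hc : Pairwise fun i j => Commute (c i) (c j)) : Pairwise fun i j =>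
      ∀ x y : Multiplicative ℕ, Commute (powersHom (Module.End ℂ V) (c i) x)
        (powersHom (Module.End ℂ V) (c j) y) :=
  fun _ _ h x y => by simpa using (hc h).pow_pow _ _

/-- `∏ₖ cₖ ^ αₖ` applied to `g`, for pairwise commuting operators `cₖ`. -/
noncomputable def excited (c : Fin n → Module.End ℂ V) (hc : Pairwise fun i j => Commute (c i) (c j))
    (g : V) (α : Fin n → ℕ) : V :=
  MonoidHom.noncommPiCoprod (fun i => powersHom (Module.End ℂ V) (c i))
    (commute_powersHom hc) (fun i => Multiplicative.ofAdd (α i)) g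

theorem excited_zero (c : Fin n → Module.End ℂ V) (hc : Pairwise fun i j => Commute (c i) (c j))
    (g : V) : excited c hc g 0 = g := by
  have : (fun i : Fin n => Multiplicative.ofAdd ((0 : Fin n → ℕ) i)) = 1 := rfl
  rw [excited, this, map_one, Module.End.one_apply]

theorem excited_raise (c : Fin n → Module.End ℂ V) (hc : Pairwise fun i j => Commute (c i) (c j))
    (g : V) (k : Fin n) (α : Fin n → ℕ) :
    excited c hc g (raise k α) = c k (excited c hc g α) := by
  have : (fun i : Fin n => Multiplicative.ofAdd (raise k α i)) =
      Pi.mulSingle k (Multiplicative.ofAdd 1) * fun i => Multiplicative.ofAdd (α i) := by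
    funext i
    rcases eq_or_ne i k with rfl | h
    · simp [raise, mul_comm]
    · simp [raise, h]
  rw [excited, this, map_mul, MonoidHom.noncommPiCoprod_mulSingle]
  simp [excited]

theorem annihilate_excited {a c : Fin n → Module.End ℂ V}
    {hc : Pairwise fun i j => Commute (c i) (c j)}
    (hac : ∀ i j v, a i (c j v) = c j (a i v) + if i = j then v else 0)
    {g : V} (hg : ∀ k, a k g = 0) (k : Fin n) (α : Fin n → ℕ) :
    a k (excited c hc g α) = (α k : ℂ) • excited c hc g (lower k α) := by
  induction α using multiIndex_induction with
  | zero => simp [excited_zero, hg]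
  | step j β ih =>
    rw [excited_raise, hac, ih, map_smul]
    rcases eq_or_ne k j with rfl | h
    · rw [lower_raise, raise_same, if_pos rfl, ← excited_raise]
      rcases eq_or_ne (β k) 0 with h0 | h0
      · simp [h0]
      · rw [raise_lower h0]
        push_cast
        rw [add_smul, one_smul]
    · rw [raise_of_ne h, if_neg h, add_zero, ← excited_raise, raise_lower_comm h]

variable {H : Type*} [NormedAddCommGroup H] [InnerProductSpace ℂ H]

theorem inner_excited_raise {a c : Fin n → Module.End ℂ V}
    {hc : Pairwise fun i j => Commute (c i) (c j)}
    (hac : ∀ i j v, a i (c j v) = c j (a i v) + if i = j then v else 0)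
    {g : V} (hg : ∀ k, a k g = 0) (L : V →ₗ[ℂ] H)
    (hL : ∀ k u v, inner ℂ (L (c k u)) (L v) = inner ℂ (L u) (L (a k v)))
    (k : Fin n) (α β : Fin n → ℕ) :
    inner ℂ (L (excited c hc g (raise k α))) (L (excited c hc g β)) =
      (β k : ℂ) * inner ℂ (L (excited c hc g α)) (L (excited c hc g (lower k β))) := by
  rw [excited_raise, hL, annihilate_excited hac hg, map_smul, inner_smul_right]

theorem inner_excited_of_ne {a c : Fin n → Module.End ℂ V}
    {hc : Pairwise fun i j => Commute (c i) (c j)}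
    (hac : ∀ i j v, a i (c j v) = c j (a i v) + if i = j then v else 0)
    {g : V} (hg : ∀ k, a k g = 0) (L : V →ₗ[ℂ] H)
    (hL : ∀ k u v, inner ℂ (L (c k u)) (L v) = inner ℂ (L u) (L (a k v)))
    {α β : Fin n → ℕ} (h : α ≠ β) :
    inner ℂ (L (excited c hc g α)) (L (excited c hc g β)) = 0 := by
  induction α using multiIndex_induction generalizing β with
  | zero =>
    induction β using multiIndex_induction with
    | zero => exact absurd rfl h
    | step k γ _ =>
      rw [← inner_conj_symm, inner_excited_raise hac hg L hL]
      simp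
  | step k α ih =>
    rw [inner_excited_raise hac hg L hL]
    rcases eq_or_ne (β k) 0 with h0 | h0
    · simp [h0]
    · rw [ih, mul_zero]
      rintro rfl
      exact h (raise_lower h0)

theorem norm_excited_raise {a c : Fin n → Module.End ℂ V}
    {hc : Pairwise fun i j => Commute (c i) (c j)}
    (hac : ∀ i j v, a i (c j v) = c j (a i v) + if i = j then v else 0)
    {g : V} (hg : ∀ k, a k g = 0) (L : V →ₗ[ℂ] H)
    (hL : ∀ k u v, inner ℂ (L (c k u)) (L v) = inner ℂ (L u) (L (a k v)))
    (k : Fin n) (α : Fin n → ℕ) :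
    ‖L (excited c hc g (raise k α))‖ = √(α k + 1 : ℝ) * ‖L (excited c hc g α)‖ := by
  have h1 := inner_excited_raise hac hg L hL (hc := hc) k α (raise k α)
  rw [lower_raise, raise_same, inner_self_eq_norm_sq_to_K, inner_self_eq_norm_sq_to_K] at h1
  have h2 : ‖L (excited c hc g (raise k α))‖ ^ 2 = (α k + 1 : ℝ) * ‖L (excited c hc g α)‖ ^ 2 := by
    have h2 : ((‖L (excited c hc g (raise k α))‖ : ℝ) : ℂ) ^ 2 =
        ((α k + 1 : ℕ) : ℂ) * ((‖L (excited c hc g α)‖ : ℝ) : ℂ) ^ 2 := h1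
    exact_mod_cast h2
  rw [← Real.sqrt_sq (norm_nonneg (L (excited c hc g (raise k α)))), h2,
    Real.sqrt_mul (by positivity), Real.sqrt_sq (norm_nonneg _)]

theorem excited_ne_zero {a c : Fin n → Module.End ℂ V}
    {hc : Pairwise fun i j => Commute (c i) (c j)}
    (hac : ∀ i j v, a i (c j v) = c j (a i v) + if i = j then v else 0)
    {g : V} (hg : ∀ k, a k g = 0) (L : V →ₗ[ℂ] H)
    (hL : ∀ k u v, inner ℂ (L (c k u)) (L v) = inner ℂ (L u) (L (a k v)))
    (h0 : L g ≠ 0) (α : Fin n → ℕ) : L (excited c hc g α) ≠ 0 := by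
  induction α using multiIndex_induction with
  | zero => rwa [excited_zero]
  | step k α ih =>
    rw [← norm_ne_zero_iff, norm_excited_raise hac hg L hL]
    exact mul_ne_zero (Real.sqrt_pos.2 (by positivity)).ne' (norm_ne_zero_iff.2 ih)

/-- The normalized vectors `∏ₖ cₖ ^ αₖ g`. -/
noncomputable def excitedUnit (c : Fin n → Module.End ℂ V)
    (hc : Pairwise fun i j => Commute (c i) (c j)) (g : V) (L : V →ₗ[ℂ] H) (α : Fin n → ℕ) : V :=
  ((‖L (excited c hc g α)‖⁻¹ : ℝ) : ℂ) • excited c hc g α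

theorem orthonormal_excitedUnit {a c : Fin n → Module.End ℂ V}
    {hc : Pairwise fun i j => Commute (c i) (c j)}
    (hac : ∀ i j v, a i (c j v) = c j (a i v) + if i = j then v else 0)
    {g : V} (hg : ∀ k, a k g = 0) (L : V →ₗ[ℂ] H)
    (hL : ∀ k u v, inner ℂ (L (c k u)) (L v) = inner ℂ (L u) (L (a k v))) (h0 : L g ≠ 0) :
    Orthonormal ℂ fun α => L (excitedUnit c hc g L α) := by
  refine ⟨fun α => ?_, fun α β h => ?_⟩
  · simp only [excitedUnit, map_smul, norm_smul, Complex.norm_real, norm_inv, norm_norm]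
    exact inv_mul_cancel₀ (norm_ne_zero_iff.2 (excited_ne_zero hac hg L hL h0 α))
  · simp only [excitedUnit, map_smul, inner_smul_left, inner_smul_right,
      inner_excited_of_ne hac hg L hL h, mul_zero]

theorem create_excitedUnit {a c : Fin n → Module.End ℂ V}
    {hc : Pairwise fun i j => Commute (c i) (c j)}
    (hac : ∀ i j v, a i (c j v) = c j (a i v) + if i = j then v else 0)
    {g : V} (hg : ∀ k, a k g = 0) (L : V →ₗ[ℂ] H)
    (hL : ∀ k u v, inner ℂ (L (c k u)) (L v) = inner ℂ (L u) (L (a k v)))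
    (k : Fin n) (α : Fin n → ℕ) :
    c k (excitedUnit c hc g L α) = (√(α k + 1 : ℝ) : ℂ) • excitedUnit c hc g L (raise k α) := by
  rw [excitedUnit, excitedUnit, map_smul, ← excited_raise, smul_smul,
    norm_excited_raise hac hg L hL]
  congr 1
  have : (√(α k + 1 : ℝ) : ℂ) ≠ 0 := by
    exact_mod_cast (Real.sqrt_pos.2 (by positivity : (0 : ℝ) < α k + 1)).ne'
  push_cast
  rw [mul_inv, mul_inv_cancel_left₀ this]

theorem annihilate_excitedUnit {a c : Fin n → Module.End ℂ V}
    {hc : Pairwise fun i j => Commute (c i) (c j)}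
    (hac : ∀ i j v, a i (c j v) = c j (a i v) + if i = j then v else 0)
    {g : V} (hg : ∀ k, a k g = 0) (L : V →ₗ[ℂ] H)
    (hL : ∀ k u v, inner ℂ (L (c k u)) (L v) = inner ℂ (L u) (L (a k v)))
    (k : Fin n) (α : Fin n → ℕ) :
    a k (excitedUnit c hc g L α) = (√(α k : ℝ) : ℂ) • excitedUnit c hc g L (lower k α) := by
  rcases eq_or_ne (α k) 0 with h | h
  · rw [excitedUnit, map_smul, annihilate_excited hac hg, h]
    simp
  · have h1 := norm_excited_raise hac hg L hL (hc := hc) k (lower k α)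
    rw [raise_lower h, lower_same] at h1
    have h2 : (((α k - 1 : ℕ) : ℝ) + 1) = α k := by
      exact_mod_cast Nat.succ_pred_eq_of_ne_zero h
    rw [h2] at h1
    rw [excitedUnit, excitedUnit, map_smul, annihilate_excited hac hg, smul_smul, smul_smul, h1]
    congr 1
    have h3 : (√(α k : ℝ) : ℂ) ≠ 0 := by
      exact_mod_cast (Real.sqrt_pos.2 (by positivity : (0 : ℝ) < α k)).ne'
    have h4 : ((α k : ℕ) : ℂ) = (√(α k : ℝ) : ℂ) * (√(α k : ℝ) : ℂ) := by
      exact_mod_cast (Real.mul_self_sqrt (Nat.cast_nonneg (α k))).symm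
    rw [h4]
    push_cast
    rw [mul_inv]
    field_simp

end LadderConstruction

section SchwartzLadder

variable {n : ℕ} {ħ : ℝ}

theorem mulCoord_comm (i j : Fin n) (f : Schwartz n) :
    mulCoord i (mulCoord j f) = mulCoord j (mulCoord i f) := by
  ext x
  simp only [mulCoord_apply]
  ring

theorem derivCoord_comm (i j : Fin n) (f : Schwartz n) :
    derivCoord i (derivCoord j f) = derivCoord j (derivCoord i f) := by
  have h : ∀ (i j : Fin n) (x : EuclideanSpace ℝ (Fin n)), derivCoord i (derivCoord j f) x =
      fderiv ℝ (fderiv ℝ f) x (EuclideanSpace.single i 1) (EuclideanSpace.single j 1) := by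
    intro i j x
    have h1 : DifferentiableAt ℝ (fderiv ℝ f) x :=
      ((f.smooth 2).fderiv_right (m := 1) (by norm_num)).differentiable (by norm_num) x
    rw [derivCoord_apply]
    exact congrArg (fun L : EuclideanSpace ℝ (Fin n) →L[ℝ] ℂ => L (EuclideanSpace.single i 1))
      (h1.hasFDerivAt.clm_apply (hasFDerivAt_const (EuclideanSpace.single j (1 : ℝ)) x)).fderiv
      |>.trans (by simp)
  ext x
  rw [h, h]
  exact ((f.smooth 2).contDiffAt.isSymmSndFDerivAt (by simp)).eq _ _

theorem derivCoord_mulCoord (i j : Fin n) (f : Schwartz n) :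
    derivCoord i (mulCoord j f) = mulCoord j (derivCoord i f) + if i = j then f else 0 := by
  ext x
  have h1 : HasFDerivAt (fun x : EuclideanSpace ℝ (Fin n) => ((x j : ℝ) : ℂ))
      (Complex.ofRealCLM.comp (EuclideanSpace.proj j : EuclideanSpace ℝ (Fin n) →L[ℝ] ℝ)) x :=
    (Complex.ofRealCLM.comp (EuclideanSpace.proj j)).hasFDerivAt
  have h2 : (mulCoord j f : EuclideanSpace ℝ (Fin n) → ℂ) = fun x => ((x j : ℝ) : ℂ) * f x :=
    funext (mulCoord_apply j f)
  have h3 := (h1.mul (f.differentiableAt (x := x)).hasFDerivAt).fderiv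
  rw [add_apply, mulCoord_apply, derivCoord_apply, derivCoord_apply, h2]
  refine (congrArg (fun L : EuclideanSpace ℝ (Fin n) →L[ℝ] ℂ =>
    L (EuclideanSpace.single i 1)) h3).trans ?_
  rcases eq_or_ne i j with rfl | h
  · simp
  · simp [h, h.symm]

/-- `q_k - Q` on Schwartz functions. -/
noncomputable def schwartzPos (Q : Fin n → ℝ) (k : Fin n) : Module.End ℂ (Schwartz n) :=
  mulCoord k - (Q k : ℂ) • 1

/-- `p_k - P` on Schwartz functions. -/
noncomputable def schwartzMom (ħ : ℝ) (P : Fin n → ℝ) (k : Fin n) : Module.End ℂ (Schwartz n) :=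
  (-(Complex.I * ħ)) • derivCoord k - (P k : ℂ) • 1

theorem schwartzPos_comm (Q : Fin n → ℝ) (i j : Fin n) (f : Schwartz n) :
    schwartzPos Q i (schwartzPos Q j f) = schwartzPos Q j (schwartzPos Q i f) := by
  simp only [schwartzPos, LinearMap.sub_apply, LinearMap.smul_apply, Module.End.one_apply, map_sub,
    map_smul, mulCoord_comm i j]
  module

theorem schwartzMom_comm (P : Fin n → ℝ) (i j : Fin n) (f : Schwartz n) :
    schwartzMom ħ P i (schwartzMom ħ P j f) = schwartzMom ħ P j (schwartzMom ħ P i f) := by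
  simp only [schwartzMom, LinearMap.sub_apply, LinearMap.smul_apply, Module.End.one_apply, map_sub,
    map_smul, derivCoord_comm i j]
  module

theorem schwartzMom_schwartzPos (Q P : Fin n → ℝ) (i j : Fin n) (f : Schwartz n) :
    schwartzMom ħ P i (schwartzPos Q j f) = schwartzPos Q j (schwartzMom ħ P i f) +
      (-(Complex.I * ħ)) • if i = j then f else 0 := by
  simp only [schwartzMom, schwartzPos, LinearMap.sub_apply, LinearMap.smul_apply,
    Module.End.one_apply, map_sub, map_smul, derivCoord_mulCoord i j]
  module

theorem toWave_mem_graph_subConst_position (Q : Fin n → ℝ) (k : Fin n) (f : Schwartz n) :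
    (toWave f, toWave (schwartzPos Q k f)) ∈ (subConst (position k) (Q k)).graph := by
  rw [mem_graph_subConst, ← map_smul, ← map_add]
  convert! toWave_mem_graph_position k f using 3
  simp [schwartzPos]

theorem toWave_mem_graph_subConst_momentum (hħ : ħ ≠ 0) (P : Fin n → ℝ) (k : Fin n)
    (f : Schwartz n) :
    (toWave f, toWave (schwartzMom ħ P k f)) ∈ (subConst (momentum ħ k) (P k)).graph := by
  rw [mem_graph_subConst, ← map_smul, ← map_add]
  convert! toWave_mem_graph_momentum hħ k f using 3
  simp [schwartzMom]

theorem inner_toWave_schwartzPos (Q : Fin n → ℝ) (k : Fin n) (f g : Schwartz n) :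
    inner ℂ (toWave (schwartzPos Q k f)) (toWave g) =
      inner ℂ (toWave f) (toWave (schwartzPos Q k g)) :=
  subConst_symm position_symm (toWave_mem_graph_subConst_position Q k f)
    (toWave_mem_graph_subConst_position Q k g)

theorem inner_toWave_schwartzMom (hħ : ħ ≠ 0) (P : Fin n → ℝ) (k : Fin n) (f g : Schwartz n) :
    inner ℂ (toWave (schwartzMom ħ P k f)) (toWave g) =
      inner ℂ (toWave f) (toWave (schwartzMom ħ P k g)) :=
  subConst_symm (momentum_symm hħ) (toWave_mem_graph_subConst_momentum hħ P k f)
    (toWave_mem_graph_subConst_momentum hħ P k g)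

variable {Q P x₀ y₀ : Fin n → ℝ}

/-- The annihilation operators `(q - Q) / (2 x₀) + i (p - P) / (2 y₀)`. -/
noncomputable def lowering (ħ : ℝ) (Q P x₀ y₀ : Fin n → ℝ) (k : Fin n) :
    Module.End ℂ (Schwartz n) :=
  (((2 * x₀ k)⁻¹ : ℝ) : ℂ) • schwartzPos Q k +
    (((2 * y₀ k)⁻¹ : ℝ) * Complex.I : ℂ) • schwartzMom ħ P k

/-- The creation operators `(q - Q) / (2 x₀) - i (p - P) / (2 y₀)`. -/
noncomputable def raising (ħ : ℝ) (Q P x₀ y₀ : Fin n → ℝ) (k : Fin n) :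
    Module.End ℂ (Schwartz n) :=
  (((2 * x₀ k)⁻¹ : ℝ) : ℂ) • schwartzPos Q k -
    (((2 * y₀ k)⁻¹ : ℝ) * Complex.I : ℂ) • schwartzMom ħ P k

theorem commute_raising :
    Pairwise fun i j => Commute (raising ħ Q P x₀ y₀ i) (raising ħ Q P x₀ y₀ j) := by
  intro i j h
  refine LinearMap.ext fun f => ?_
  simp only [Module.End.mul_apply, raising, LinearMap.sub_apply, LinearMap.smul_apply, map_sub,
    map_smul, schwartzPos_comm Q i j, schwartzMom_comm P i j, schwartzMom_schwartzPos, if_neg h,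
    if_neg h.symm]
  module

theorem lowering_raising (hx : ∀ k, 0 < x₀ k) (hy : ∀ k, 0 < y₀ k)
    (hxy : ∀ k, 2 * x₀ k * y₀ k = ħ) (i j : Fin n) (f : Schwartz n) :
    lowering ħ Q P x₀ y₀ i (raising ħ Q P x₀ y₀ j f) =
      raising ħ Q P x₀ y₀ j (lowering ħ Q P x₀ y₀ i f) + if i = j then f else 0 := by
  rcases eq_or_ne i j with rfl | h
  · have h1 : (2 : ℂ) * (((2 * x₀ i)⁻¹ : ℝ) * ((2 * y₀ i)⁻¹ : ℝ)) * ħ = 1 := by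
      rw [← hxy i]
      have := (hx i).ne'
      have := (hy i).ne'
      norm_cast
      field_simp
    have h2 : f = (-(2 * (((2 * x₀ i)⁻¹ : ℝ) * ((2 * y₀ i)⁻¹ : ℝ)) *
        (Complex.I * (Complex.I * ħ))) : ℂ) • f := by
      rw [← mul_assoc Complex.I, Complex.I_mul_I, neg_one_mul, mul_neg, neg_neg, h1, one_smul]
    simp only [lowering, raising, LinearMap.sub_apply, LinearMap.add_apply, LinearMap.smul_apply,
      map_sub, map_add, map_smul, schwartzMom_schwartzPos, if_true]
    linear_combination (norm := module) (-1 : ℂ) • h2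
  · simp only [lowering, raising, LinearMap.sub_apply, LinearMap.add_apply, LinearMap.smul_apply,
      map_sub, map_add, map_smul, schwartzPos_comm Q i j, schwartzMom_comm P i j,
      schwartzMom_schwartzPos, if_neg h, if_neg h.symm]
    module

theorem inner_toWave_raising (hħ : ħ ≠ 0) (k : Fin n) (f g : Schwartz n) :
    inner ℂ (toWave (raising ħ Q P x₀ y₀ k f)) (toWave g) =
      inner ℂ (toWave f) (toWave (lowering ħ Q P x₀ y₀ k g)) := by
  simp only [lowering, raising, LinearMap.sub_apply, LinearMap.add_apply, LinearMap.smul_apply,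
    map_sub, map_add, map_smul, inner_sub_left, inner_add_right, inner_smul_left, inner_smul_right,
    inner_toWave_schwartzPos, inner_toWave_schwartzMom hħ, map_mul, Complex.conj_ofReal,
    Complex.conj_I]
  ring

theorem schwartzPos_eq (hx : ∀ k, 0 < x₀ k) (k : Fin n) (f : Schwartz n) :
    schwartzPos Q k f = (x₀ k : ℂ) • (raising ħ Q P x₀ y₀ k f + lowering ħ Q P x₀ y₀ k f) := by
  have : (x₀ k : ℂ) ≠ 0 := by exact_mod_cast (hx k).ne'
  simp only [lowering, raising, LinearMap.sub_apply, LinearMap.add_apply, LinearMap.smul_apply]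
  push_cast
  match_scalars
  · field_simp
    norm_num
  · ring

theorem schwartzMom_eq (hy : ∀ k, 0 < y₀ k) (k : Fin n) (f : Schwartz n) :
    schwartzMom ħ P k f =
      (y₀ k * Complex.I : ℂ) • (raising ħ Q P x₀ y₀ k f - lowering ħ Q P x₀ y₀ k f) := by
  have : (y₀ k : ℂ) ≠ 0 := by exact_mod_cast (hy k).ne'
  simp only [lowering, raising, LinearMap.sub_apply, LinearMap.add_apply, LinearMap.smul_apply]
  push_cast
  match_scalars
  · field_simp
    linear_combination (2 : ℂ) * Complex.I_sq
  · ring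

/-- The width parameters of the ground state. -/
noncomputable def groundWidth (ħ : ℝ) (x₀ y₀ : Fin n → ℝ) (k : Fin n) : ℝ :=
  y₀ k / (2 * ħ * x₀ k)

theorem groundWidth_pos (hħ : 0 < ħ) (hx : ∀ k, 0 < x₀ k) (hy : ∀ k, 0 < y₀ k) (k : Fin n) :
    0 < groundWidth ħ x₀ y₀ k :=
  div_pos (hy k) (mul_pos (by positivity) (hx k))

theorem lowering_gaussianPacket (hħ : 0 < ħ) (hx : ∀ k, 0 < x₀ k) (hy : ∀ k, 0 < y₀ k)
    (k : Fin n) :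
    lowering ħ Q P x₀ y₀ k
      (gaussianPacket (groundWidth_pos hħ hx hy) Q fun k => P k / ħ) = 0 := by
  have h1 : (x₀ k : ℂ) ≠ 0 := by exact_mod_cast (hx k).ne'
  have h2 : (y₀ k : ℂ) ≠ 0 := by exact_mod_cast (hy k).ne'
  have h3 : (ħ : ℂ) ≠ 0 := by exact_mod_cast hħ.ne'
  ext x
  simp only [lowering, schwartzPos, schwartzMom, LinearMap.sub_apply, LinearMap.add_apply,
    LinearMap.smul_apply, Module.End.one_apply, add_apply, sub_apply,
    smul_apply, zero_apply, mulCoord_apply, derivCoord_gaussianPacket,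
    smul_eq_mul, groundWidth]
  generalize gaussianPacket _ _ _ x = z
  push_cast
  field_simp
  linear_combination (z * (x k - Q k) * y₀ k - z * Complex.I * x₀ k * P k) * Complex.I_sq

end SchwartzLadder

section Completeness

open FourierTransform

theorem ae_eq_zero_of_fourier_eq_zero {E : Type*} [NormedAddCommGroup E] [InnerProductSpace ℝ E]
    [FiniteDimensional ℝ E] [MeasurableSpace E] [BorelSpace E] {F : E → ℂ} (hF : Integrable F)
    (h : ∀ ξ, 𝓕 F ξ = 0) : F =ᵐ[volume] 0 := by
  refine ae_eq_zero_of_integral_contDiff_smul_eq_zero hF.locallyIntegrable fun u hu hc => ?_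
  have hu' : ContDiff ℝ (⊤ : ℕ∞) fun x => (u x : ℂ) := Complex.ofRealCLM.contDiff.comp hu
  have hc' : HasCompactSupport fun x => (u x : ℂ) := hc.comp_left Complex.ofReal_zero
  let f : SchwartzMap E ℂ := hc'.toSchwartzMap hu'
  have h1 : ∀ G : SchwartzMap E ℂ, ∫ ξ, 𝓕 G ξ • F ξ = ∫ x, G x • 𝓕 F x := fun G => by
    simpa using! VectorFourier.integral_bilin_fourierIntegral_eq_flip
      (ContinuousLinearMap.lsmul ℂ ℂ) (L := innerₗ E) Real.continuous_fourierChar continuous_inner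
      (G.integrable (μ := volume)) hF
  have h1 := h1 (𝓕⁻ f)
  simp only [h, smul_zero, integral_zero, FourierTransform.fourier_fourierInv_eq] at h1
  rw [← h1]
  rfl

variable {n : ℕ}

theorem integrable_mul_gaussianPacket {s : Fin n → ℝ} (hs : ∀ k, 0 < s k) (Q p : Fin n → ℝ)
    (ψ : Wave n) {R : ℝ} (hR : 0 ≤ R) :
    Integrable fun x => Real.exp (R * ‖x‖) * (‖ψ x‖ * ‖gaussianPacket hs Q p x‖) := by
  have hs' : ∀ k, 0 < s k / 2 := fun k => half_pos (hs k)
  obtain ⟨C, hC⟩ := exists_re_packetExponent_le hs' Q p hR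
  have h1 : Integrable fun x => Real.exp C * (‖ψ x‖ * ‖gaussianPacket hs' Q p x‖) :=
    (((Lp.memLp ψ).norm).integrable_mul ((gaussianPacket hs' Q p).memLp 2 volume).norm).const_mul _
  refine h1.mono' ?_ (ae_of_all _ fun x => ?_)
  · refine AEStronglyMeasurable.mul (Continuous.aestronglyMeasurable (by fun_prop)) ?_
    exact (Lp.aestronglyMeasurable ψ).norm.mul
      (gaussianPacket hs Q p).continuous.norm.aestronglyMeasurable
  · rw [Real.norm_of_nonneg (by positivity), gaussianPacket_apply, gaussianPacket_apply,
      Complex.norm_exp, Complex.norm_exp]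
    have h2 : (packetExponent s Q p x).re =
        (packetExponent (fun k => s k / 2) Q p x).re +
          (packetExponent (fun k => s k / 2) Q p x).re := by
      simp only [re_packetExponent, ← Finset.sum_add_distrib]
      refine Finset.sum_congr rfl fun k _ => ?_
      ring
    have h3 : Real.exp (R * ‖x‖) * Real.exp (packetExponent s Q p x).re ≤
        Real.exp C * Real.exp (packetExponent (fun k => s k / 2) Q p x).re := by
      rw [← Real.exp_add, ← Real.exp_add, Real.exp_le_exp, h2]
      linarith [hC x]
    calc _ = ‖ψ x‖ * (Real.exp (R * ‖x‖) * Real.exp (packetExponent s Q p x).re) := by ring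
      _ ≤ ‖ψ x‖ * (Real.exp C * Real.exp (packetExponent (fun k => s k / 2) Q p x).re) := by gcongr
      _ = _ := by ring

theorem integral_moment_eq_zero {g : Schwartz n} {W : Submodule ℂ (Schwartz n)} (hg : g ∈ W)
    (hW : ∀ k, ∀ f ∈ W, mulCoord k f ∈ W) {ψ : Wave n}
    (hψ : ∀ f ∈ W, inner ℂ (toWave f) ψ = 0) (ξ : EuclideanSpace ℝ (Fin n)) (m : ℕ) :
    ∫ x, ((inner ℝ x ξ : ℝ) : ℂ) ^ m * (ψ x * (starRingEnd ℂ) (g x)) = 0 := by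
  have h1 : ∃ f ∈ W, ∀ x, f x = ((inner ℝ x ξ : ℝ) : ℂ) ^ m * g x := by
    induction m with
    | zero => exact ⟨g, hg, fun x => by simp⟩
    | succ m ih =>
      obtain ⟨f, hf, hfx⟩ := ih
      refine ⟨∑ k, (ξ k : ℂ) • mulCoord k f,
        Submodule.sum_mem _ fun k _ => Submodule.smul_mem _ _ (hW k f hf), fun x => ?_⟩
      have h2 : ((inner ℝ x ξ : ℝ) : ℂ) = ∑ k, (ξ k : ℂ) * (x k : ℂ) := by
        rw [PiLp.inner_apply, Complex.ofReal_sum]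
        exact Finset.sum_congr rfl fun k _ => Complex.ofReal_mul _ _
      simp only [sum_apply, smul_apply, mulCoord_apply, hfx, smul_eq_mul, pow_succ]
      calc _ = (∑ k, (ξ k : ℂ) * (x k : ℂ)) * (((inner ℝ x ξ : ℝ) : ℂ) ^ m * g x) := by
            rw [Finset.sum_mul]
            exact Finset.sum_congr rfl fun k _ => by ring
        _ = _ := by
            rw [← h2]
            ring
  obtain ⟨f, hf, hfx⟩ := h1
  have h2 := hψ f hf
  rw [L2.inner_def] at h2
  rw [← h2]
  refine integral_congr_ae ?_
  filter_upwards [coeFn_toWave f] with x hx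
  rw [hx, hfx, RCLike.inner_apply, map_mul, map_pow, Complex.conj_ofReal]
  ring

theorem eq_zero_of_forall_inner_eq_zero {s : Fin n → ℝ} (hs : ∀ k, 0 < s k) {Q p : Fin n → ℝ}
    {W : Submodule ℂ (Schwartz n)} (hg : gaussianPacket hs Q p ∈ W)
    (hW : ∀ k, ∀ f ∈ W, mulCoord k f ∈ W) {ψ : Wave n}
    (hψ : ∀ f ∈ W, inner ℂ (toWave f) ψ = 0) : ψ = 0 := by
  set g := gaussianPacket hs Q p with hgdef
  have hm : AEStronglyMeasurable (fun x => ψ x * (starRingEnd ℂ) (g x)) volume :=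
    (Lp.aestronglyMeasurable ψ).mul
      (Complex.continuous_conj.comp g.continuous).aestronglyMeasurable
  have hn : ∀ x, ‖ψ x * (starRingEnd ℂ) (g x)‖ = ‖ψ x‖ * ‖g x‖ := fun x => by
    rw [norm_mul, RCLike.norm_conj]
  have hF : Integrable fun x => ψ x * (starRingEnd ℂ) (g x) := by
    refine (integrable_mul_gaussianPacket hs Q p ψ le_rfl).mono' hm (ae_of_all _ fun x => ?_)
    rw [hn]
    simp [g]
  have h0 : ∀ ξ, 𝓕 (fun x => ψ x * (starRingEnd ℂ) (g x)) ξ = 0 := by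
    intro ξ
    have hsum := hasSum_integral_of_dominated_convergence (μ := volume)
      (F := fun (m : ℕ) (x : EuclideanSpace ℝ (Fin n)) =>
        ((-(2 * Real.pi * Complex.I)) ^ m / (m.factorial : ℂ)) *
          (((inner ℝ x ξ : ℝ) : ℂ) ^ m * (ψ x * (starRingEnd ℂ) (g x))))
      (f := fun x => Real.fourierChar (-(inner ℝ x ξ)) • (ψ x * (starRingEnd ℂ) (g x)))
      (fun m x => ((2 * Real.pi * ‖ξ‖) * ‖x‖) ^ m / m.factorial * (‖ψ x‖ * ‖g x‖))
      (fun m => ?_) (fun m => ae_of_all _ fun x => ?_) (ae_of_all _ fun x => ?_) ?_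
      (ae_of_all _ fun x => ?_)
    · rw [Real.fourier_eq]
      refine hsum.unique ?_
      simp only [integral_const_mul, integral_moment_eq_zero hg hW hψ, mul_zero]
      exact hasSum_zero
    · refine AEStronglyMeasurable.const_mul (AEStronglyMeasurable.mul ?_ hm) _
      exact Continuous.aestronglyMeasurable (by fun_prop)
    · rw [norm_mul, norm_mul, hn, norm_div, norm_pow, norm_pow, norm_neg, norm_mul, norm_mul,
        Complex.norm_I, Complex.norm_natCast, Complex.norm_real, Complex.norm_real, mul_one,
        ← mul_assoc, Real.norm_of_nonneg Real.pi_pos.le, Complex.norm_two]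
      have h1 : ‖inner ℝ x ξ‖ ≤ ‖ξ‖ * ‖x‖ := by
        rw [mul_comm]
        exact norm_inner_le_norm x ξ
      refine mul_le_mul_of_nonneg_right ?_ (by positivity)
      calc _ = ((2 * Real.pi) * ‖inner ℝ x ξ‖) ^ m / m.factorial := by rw [mul_pow]; ring
        _ ≤ ((2 * Real.pi) * (‖ξ‖ * ‖x‖)) ^ m / m.factorial := by
          gcongr
        _ = _ := by rw [mul_assoc (2 * Real.pi)]
    · exact (Real.summable_pow_div_factorial _).mul_right _
    · refine (integrable_mul_gaussianPacket hs Q p ψ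
        (R := 2 * Real.pi * ‖ξ‖) (by positivity)).congr (ae_of_all _ fun x => ?_)
      simp only [tsum_mul_right]
      rw [Real.exp_eq_exp_ℝ, NormedSpace.exp_eq_tsum_div]
    · have h1 := (NormedSpace.expSeries_div_hasSum_exp
        (-(2 * Real.pi * Complex.I) * ((inner ℝ x ξ : ℝ) : ℂ))).mul_right
        (ψ x * (starRingEnd ℂ) (g x))
      convert! h1 using 1
      · funext m
        rw [mul_pow]
        ring
      · rw [Circle.smul_def, Real.fourierChar_apply, ← Complex.exp_eq_exp_ℂ, smul_eq_mul]
        congr 2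
        push_cast
        ring
  have h1 := ae_eq_zero_of_fourier_eq_zero hF h0
  refine Lp.ext ?_
  filter_upwards [h1, Lp.coeFn_zero ℂ 2 (volume : Measure (EuclideanSpace ℝ (Fin n)))] with x hx hz
  rw [hz]
  refine (mul_eq_zero.1 hx).resolve_right ?_
  rw [hgdef, gaussianPacket_apply]
  simp

end Completeness

section HermiteBasis

variable {n : ℕ} {ħ : ℝ} {Q P x₀ y₀ : Fin n → ℝ}

/-- The ground state of the ladder operators. -/
noncomputable def groundPacket (hħ : 0 < ħ) (Q P : Fin n → ℝ) (hx : ∀ k, 0 < x₀ k)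
    (hy : ∀ k, 0 < y₀ k) : Schwartz n :=
  gaussianPacket (groundWidth_pos hħ hx hy) Q fun k => P k / ħ

theorem toWave_groundPacket_ne_zero (hħ : 0 < ħ) (hx : ∀ k, 0 < x₀ k) (hy : ∀ k, 0 < y₀ k) :
    toWave (groundPacket hħ Q P hx hy) ≠ 0 := by
  intro h
  have h1 : groundPacket hħ Q P hx hy = 0 :=
    SchwartzMap.injective_toLp 2 volume (h.trans (map_zero toWave).symm)
  have h2 := DFunLike.congr_fun h1 0
  rw [groundPacket, gaussianPacket_apply] at h2
  exact Complex.exp_ne_zero _ h2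

/-- The Hermite functions `∏ₖ (aₖ†) ^ αₖ g`, normalized, as Schwartz functions. -/
noncomputable def hermiteFunction (hħ : 0 < ħ) (Q P : Fin n → ℝ) (hx : ∀ k, 0 < x₀ k)
    (hy : ∀ k, 0 < y₀ k) (α : Fin n → ℕ) : Schwartz n :=
  excitedUnit (raising ħ Q P x₀ y₀) commute_raising (groundPacket hħ Q P hx hy) toWave α

theorem raising_hermiteFunction (hħ : 0 < ħ) (hx : ∀ k, 0 < x₀ k) (hy : ∀ k, 0 < y₀ k)
    (hxy : ∀ k, 2 * x₀ k * y₀ k = ħ) (k : Fin n) (α : Fin n → ℕ) :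
    raising ħ Q P x₀ y₀ k (hermiteFunction hħ Q P hx hy α) =
      (√(α k + 1 : ℝ) : ℂ) • hermiteFunction hħ Q P hx hy (raise k α) :=
  create_excitedUnit (lowering_raising hx hy hxy) (lowering_gaussianPacket hħ hx hy) toWave
    (inner_toWave_raising hħ.ne') k α

theorem lowering_hermiteFunction (hħ : 0 < ħ) (hx : ∀ k, 0 < x₀ k) (hy : ∀ k, 0 < y₀ k)
    (hxy : ∀ k, 2 * x₀ k * y₀ k = ħ) (k : Fin n) (α : Fin n → ℕ) :
    lowering ħ Q P x₀ y₀ k (hermiteFunction hħ Q P hx hy α) =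
      (√(α k : ℝ) : ℂ) • hermiteFunction hħ Q P hx hy (lower k α) :=
  annihilate_excitedUnit (lowering_raising hx hy hxy) (lowering_gaussianPacket hħ hx hy) toWave
    (inner_toWave_raising hħ.ne') k α

theorem orthonormal_hermiteFunction (hħ : 0 < ħ) (hx : ∀ k, 0 < x₀ k) (hy : ∀ k, 0 < y₀ k)
    (hxy : ∀ k, 2 * x₀ k * y₀ k = ħ) :
    Orthonormal ℂ fun α => toWave (hermiteFunction hħ Q P hx hy α) :=
  orthonormal_excitedUnit (lowering_raising hx hy hxy) (lowering_gaussianPacket hħ hx hy) toWave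
    (inner_toWave_raising hħ.ne') (toWave_groundPacket_ne_zero hħ hx hy)

theorem mulCoord_mem_span_hermiteFunction (hħ : 0 < ħ) (hx : ∀ k, 0 < x₀ k) (hy : ∀ k, 0 < y₀ k)
    (hxy : ∀ k, 2 * x₀ k * y₀ k = ħ) (k : Fin n) (f : Schwartz n)
    (hf : f ∈ Submodule.span ℂ (Set.range (hermiteFunction hħ Q P hx hy))) :
    mulCoord k f ∈ Submodule.span ℂ (Set.range (hermiteFunction hħ Q P hx hy)) := by
  have h1 : ∀ α, hermiteFunction hħ Q P hx hy α ∈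
      Submodule.span ℂ (Set.range (hermiteFunction hħ Q P hx hy)) :=
    fun α => Submodule.subset_span ⟨α, rfl⟩
  induction hf using Submodule.span_induction with
  | mem f hf =>
    obtain ⟨α, rfl⟩ := hf
    have h2 : mulCoord k (hermiteFunction hħ Q P hx hy α) =
        schwartzPos Q k (hermiteFunction hħ Q P hx hy α) +
          (Q k : ℂ) • hermiteFunction hħ Q P hx hy α := by
      simp [schwartzPos]
    rw [h2, schwartzPos_eq (ħ := ħ) (P := P) (y₀ := y₀) hx, raising_hermiteFunction hħ hx hy hxy,
      lowering_hermiteFunction hħ hx hy hxy]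
    exact add_mem (Submodule.smul_mem _ _ (add_mem (Submodule.smul_mem _ _ (h1 _))
      (Submodule.smul_mem _ _ (h1 _)))) (Submodule.smul_mem _ _ (h1 _))
  | zero => simp
  | add f g _ _ hf hg =>
    rw [map_add]
    exact add_mem hf hg
  | smul c f _ hf =>
    rw [map_smul]
    exact Submodule.smul_mem _ _ hf

theorem groundPacket_mem_span_hermiteFunction (hħ : 0 < ħ) (hx : ∀ k, 0 < x₀ k)
    (hy : ∀ k, 0 < y₀ k) : groundPacket hħ Q P hx hy ∈
      Submodule.span ℂ (Set.range (hermiteFunction hħ Q P hx hy)) := by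
  have h1 : ((‖toWave (groundPacket hħ Q P hx hy)‖ : ℝ) : ℂ) ≠ 0 := by
    exact_mod_cast norm_ne_zero_iff.2 (toWave_groundPacket_ne_zero hħ hx hy)
  have h2 : groundPacket hħ Q P hx hy = ((‖toWave (groundPacket hħ Q P hx hy)‖ : ℝ) : ℂ) •
      hermiteFunction hħ Q P hx hy 0 := by
    rw [hermiteFunction, excitedUnit, excited_zero, smul_smul, Complex.ofReal_inv,
      mul_inv_cancel₀ h1, one_smul]
  rw [h2]
  exact Submodule.smul_mem _ _ (Submodule.subset_span ⟨0, rfl⟩)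

theorem orthogonal_span_hermiteFunction (hħ : 0 < ħ) (hx : ∀ k, 0 < x₀ k) (hy : ∀ k, 0 < y₀ k)
    (hxy : ∀ k, 2 * x₀ k * y₀ k = ħ) :
    (Submodule.span ℂ (Set.range fun α => toWave (hermiteFunction hħ Q P hx hy α)))ᗮ = ⊥ := by
  rw [Submodule.eq_bot_iff]
  intro ψ hψ
  refine eq_zero_of_forall_inner_eq_zero (groundWidth_pos hħ hx hy)
    (groundPacket_mem_span_hermiteFunction hħ hx hy)
    (mulCoord_mem_span_hermiteFunction (Q := Q) (P := P) hħ hx hy hxy) fun f hf => ?_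
  refine (Submodule.mem_orthogonal _ _).1 hψ _ ?_
  have h1 := Submodule.mem_map_of_mem (f := toWave) hf
  rwa [Submodule.map_span, ← Set.range_comp] at h1

/-- The orthonormal basis of Hermite functions. -/
noncomputable def hermiteBasis (hħ : 0 < ħ) (Q P : Fin n → ℝ) (hx : ∀ k, 0 < x₀ k)
    (hy : ∀ k, 0 < y₀ k) (hxy : ∀ k, 2 * x₀ k * y₀ k = ħ) :
    HilbertBasis (Fin n → ℕ) ℂ (Wave n) :=
  HilbertBasis.mkOfOrthogonalEqBot (orthonormal_hermiteFunction (Q := Q) (P := P) hħ hx hy hxy)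
    (orthogonal_span_hermiteFunction hħ hx hy hxy)

theorem hermiteBasis_apply (hħ : 0 < ħ) (hx : ∀ k, 0 < x₀ k) (hy : ∀ k, 0 < y₀ k)
    (hxy : ∀ k, 2 * x₀ k * y₀ k = ħ) (α : Fin n → ℕ) :
    hermiteBasis hħ Q P hx hy hxy α = toWave (hermiteFunction hħ Q P hx hy α) := by
  rw [hermiteBasis, HilbertBasis.coe_mkOfOrthogonalEqBot]

theorem isLadder_position (hħ : 0 < ħ) (hx : ∀ k, 0 < x₀ k) (hy : ∀ k, 0 < y₀ k)
    (hxy : ∀ k, 2 * x₀ k * y₀ k = ħ) (k : Fin n) :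
    IsLadder (hermiteBasis hħ Q P hx hy hxy) k (subConst (position k) (Q k)) (x₀ k : ℂ) where
  closed := isClosed_subConst (isClosed_position k) _
  symm := subConst_symm position_symm
  basis α := by
    have h := toWave_mem_graph_subConst_position Q k (hermiteFunction hħ Q P hx hy α)
    rw [schwartzPos_eq (ħ := ħ) (P := P) (y₀ := y₀) hx, raising_hermiteFunction hħ hx hy hxy,
      lowering_hermiteFunction hħ hx hy hxy] at h
    convert! h using 2
    · exact hermiteBasis_apply hħ hx hy hxy α
    · simp only [ladderVec, hermiteBasis_apply, map_smul, map_add, smul_add, smul_smul,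
        RCLike.star_def, Complex.conj_ofReal]

theorem isLadder_momentum (hħ : 0 < ħ) (hx : ∀ k, 0 < x₀ k) (hy : ∀ k, 0 < y₀ k)
    (hxy : ∀ k, 2 * x₀ k * y₀ k = ħ) (k : Fin n) :
    IsLadder (hermiteBasis hħ Q P hx hy hxy) k (subConst (momentum ħ k) (P k))
      (y₀ k * Complex.I : ℂ) where
  closed := isClosed_subConst (isClosed_momentum hħ.ne' k) _
  symm := subConst_symm (momentum_symm hħ.ne')
  basis α := by
    have h := toWave_mem_graph_subConst_momentum hħ.ne' P k (hermiteFunction hħ Q P hx hy α)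
    rw [schwartzMom_eq (Q := Q) (x₀ := x₀) hy, raising_hermiteFunction hħ hx hy hxy,
      lowering_hermiteFunction hħ hx hy hxy] at h
    convert! h using 2
    · exact hermiteBasis_apply hħ hx hy hxy α
    · simp only [ladderVec, hermiteBasis_apply, map_smul, map_sub, RCLike.star_def, map_mul,
        Complex.conj_ofReal, Complex.conj_I]
      module

end HermiteBasis

end QM

theorem theorem1 (n : ℕ) (ħ : ℝ) (hħ : 0 < ħ) (Q P ΔQ ΔP : Fin n → ℝ)
    (hΔQ : ∀ k, 0 < ΔQ k) (hΔP : ∀ k, 0 < ΔP k)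
    (hν : ∀ k, 1 < QM.nu ħ (ΔQ k) (ΔP k))
    (ρ : QM.Wave n →L[ℂ] QM.Wave n) :
    QM.IsMaxEntropyPacket ħ Q P ΔQ ΔP ρ ↔ ρ = QM.packetT ħ Q P ΔQ ΔP := by
  have hx : ∀ k, 0 < √(ħ * ΔQ k / (2 * ΔP k)) := fun k =>
    Real.sqrt_pos.2 (div_pos (mul_pos hħ (hΔQ k)) (mul_pos two_pos (hΔP k)))
  have hy : ∀ k, 0 < √(ħ * ΔP k / (2 * ΔQ k)) := fun k =>
    Real.sqrt_pos.2 (div_pos (mul_pos hħ (hΔP k)) (mul_pos two_pos (hΔQ k)))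
  have hxy : ∀ k, 2 * √(ħ * ΔQ k / (2 * ΔP k)) * √(ħ * ΔP k / (2 * ΔQ k)) = ħ := fun k => by
    have h1 := (hΔQ k).ne'
    have h2 := (hΔP k).ne'
    have h3 : ħ * ΔQ k / (2 * ΔP k) * (ħ * ΔP k / (2 * ΔQ k)) = (ħ / 2) ^ 2 := by
      field_simp
    rw [mul_assoc, ← Real.sqrt_mul (Real.sqrt_pos.1 (hx k)).le, h3, Real.sqrt_sq (by positivity)]
    ring
  exact QM.isMaxEntropyPacket_iff_of_isLadder hħ hΔQ hΔP hν
    (QM.isLadder_position hħ hx hy hxy) (QM.isLadder_momentum hħ hx hy hxy) ρ
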